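/- **Setting.** Let $d\in\{2,3\}$ and let $\Omega\subset\mathbb R^d$ be a nonempty open bounded convex polygonal/polyhedral domain with outward unit normal $\boldsymbol n$. Write $(\cdot,\cdot)$, $\|\cdot\|$ for the $L^2(\Omega)$ inner product and norm (of scalar or vector functions). Let $M,\lambda,\nu,\epsilon,\beta,\delta_0,\theta>0$, $G(\phi)=\frac1{4\epsilon^2}(1-\phi^2)^2$, $F(\phi)=G(\phi)-\frac\beta2\phi^2$, $E_1(\phi)=\int_\Omega F(\phi)\,d\boldsymbol x$, and assume $E_1(\phi)+\delta_0>0$ for all $\phi\in H^2(\Omega)$. Put $b(\boldsymbol u,\boldsymbol v,\boldsymbol w)=(\boldsymbol u\cdot\nabla\boldsymbol v,\boldsymbol w)$. Let $T>0$, $N_t\ge1$, $\tau=T/N_t$. For $n\ge1$ put $w^{*}=2w^n-w^{n-1}$, $\mathcal D_2w^{n+1}=\frac{3w^{n+1}-4w^n+w^{n-1}}{2\tau}$, $\widehat{\mathcal D}_2\boldsymbol u^{n+1}=\frac{3\widehat{\boldsymbol u}^{n+1}-4\boldsymbol u^n+\boldsymbol u^{n-1}}{2\tau}$. **Scheme.**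 The initial level consists of $\phi^0\in H^2(\Omega)$, $\boldsymbol u^0\in H^2(\Omega)^d\cap H^1_0(\Omega)^d$ with $\nabla\cdot\boldsymbol u^0=0$, $\mu^0,p^0\in H^1(\Omega)$ and $R^0=\sqrt{E_1(\phi^0)+\delta_0}$. All later levels satisfy $\phi^{n},\mu^{n}\in H^2(\Omega)$, $\partial_{\boldsymbol n}\phi^n=\partial_{\boldsymbol n}\mu^n=0$ on $\partial\Omega$, $\widehat{\boldsymbol u}^n,\boldsymbol u^n\in H^2(\Omega)^d\cap H_0^1(\Omega)^d$, $p^n\in H^1(\Omega)$, $R^n\in\mathbb R$, and the equations below a.e. in $\Omega$. For $1\le n\le N_t-1$ (the BDF2-based second-order IVS scheme), with a real parameter $\gamma^*=\gamma^*_n$ (arbitrary; in practice computed from the known pressures) and $\xi^{n+1}=R^{n+1}/\sqrt{E_1(\phi^*)+\delta_0}$, $$\mathcal D_2\phi^{n+1}+\xi^{n+1}\nabla\cdot(\boldsymbol u^*\phi^*)=M\Delta\mu^{n+1},\qquad \mu^{n+1}=-\lambda\Delta\phi^{n+1}+\lambda\beta\phi^{n+1}+\lambda\xi^{n+1}F'(\phi^*),$$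 $$\widehat{\mathcal D}_2\boldsymbol u^{n+1}+\xi^{n+1}\boldsymbol u^*\cdot\nabla\boldsymbol u^*-\nu\Delta\widehat{\boldsymbol u}^{n+1}=-\xi^{n+1}(\phi^*\nabla\mu^*+\gamma^*\nabla p^*),$$ $$\mathcal D_2R^{n+1}=\frac{\lambda(F'(\phi^*),\mathcal D_2\phi^{n+1})+(\mu^{n+1},\nabla\cdot(\boldsymbol u^*\phi^*))+(\widehat{\boldsymbol u}^{n+1},\phi^*\nabla\mu^*)+b(\boldsymbol u^*,\boldsymbol u^*,\widehat{\boldsymbol u}^{n+1})+\gamma^*(\nabla p^*,\widehat{\boldsymbol u}^{n+1})}{2\lambda\sqrt{E_1(\phi^*)+\delta_0}},$$ $$\tfrac{3}{2\tau}(\boldsymbol u^{n+1}-\widehat{\boldsymbol u}^{n+1})-\nu\Delta(\boldsymbol u^{n+1}-\widehat{\boldsymbol u}^{n+1})+\nabla p^{n+1}=\gamma^*\nabla p^*,\qquad \nabla\cdot\boldsymbol u^{n+1}=0.$$ Level $1$ is computed from level $0$ by the first-order scheme, i.e. by the same equations with $n=0$, in which every $w^*$ is replaced by $w^0$, $\gamma^*$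 by $\gamma^0=\theta/(\|\nabla p^0\|+1)$, $\mathcal D_2w^{1}$ by $(w^1-w^0)/\tau$, $\widehat{\mathcal D}_2\boldsymbol u^1$ by $(\widehat{\boldsymbol u}^1-\boldsymbol u^0)/\tau$, and $\frac3{2\tau}$ by $\frac1\tau$. **Theorem.** Every solution of this scheme conserves mass, $$(\phi^{n+1},1)=(\phi^n,1),\qquad 0\le n\le N_t-1,$$ and satisfies, for $0\le n\le N_t-1$, the unconditional energy dissipation law $$\widetilde E^{n+1}-\widetilde E^n\le-M\tau\|\nabla\mu^{n+1}\|^2-\frac{\nu\tau}6\big(\|\nabla(\boldsymbol u^{n+1}-\widehat{\boldsymbol u}^{n+1})\|^2+\|\nabla\widehat{\boldsymbol u}^{n+1}\|^2\big),$$ where, for $0\le m\le N_t$, $$\begin{aligned}\widetilde E^{m}:={}&\tfrac14\big(\|\boldsymbol u^{m}\|^2+\|2\boldsymbol u^{m}-\boldsymbol u^{m-1}\|^2\big)+\tfrac\lambda4\big(\|\nabla\phi^{m}\|^2+\|\nabla(2\phi^{m}-\phi^{m-1})\|^2\big)\\&+\tfrac{\lambda\beta}4\big(\|\phi^{m}\|^2+\|2\phi^{m}-\phi^{m-1}\|^2\big)+\tfrac\lambda2\big(|R^{m}|^2+|2R^{m}-R^{m-1}|^2\big)+\tfrac{\nu\tau}6\|\nabla\boldsymbol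 u^{m}\|^2,\end{aligned}$$ with the convention $w^{-1}:=w^0$ in $\widetilde E^0$. -/

import Mathlib

open MeasureTheory Filter Topology
open scoped ContDiff

noncomputable section

namespace CHNS

/-- The Euclidean space `ℝ^d`. -/
abbrev Pt (d : ℕ) : Type := EuclideanSpace ℝ (Fin d)

/-! ### Weak derivatives and Sobolev spaces on an open set `Ω` -/

section Sobolev

variable {d : ℕ}

/-- Test functions: smooth functions with compact support contained in `Ω`. -/
def IsTest (Ω : Set (Pt d)) (ψ : Pt d → ℝ) : Prop :=
  ContDiff ℝ ∞ ψ ∧ HasCompactSupport ψ ∧ tsupport ψ ⊆ Ω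

/-- The classical partial derivative in the `i`-th coordinate direction. -/
def classicalPartial (i : Fin d) (ψ : Pt d → ℝ) (x : Pt d) : ℝ :=
  fderiv ℝ ψ x (EuclideanSpace.single i 1)

/-- `g` is the weak `i`-th partial derivative of `f` in `Ω`. -/
def HasWeakPartial (Ω : Set (Pt d)) (i : Fin d) (f g : Pt d → ℝ) : Prop :=
  LocallyIntegrableOn f Ω ∧ LocallyIntegrableOn g Ω ∧
    ∀ ψ : Pt d → ℝ, IsTest Ω ψ →
      ∫ x in Ω, f x * classicalPartial i ψ x = - ∫ x in Ω, g x * ψ x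

open Classical in
/-- The weak `i`-th partial derivative (unique almost everywhere in `Ω`; the value is `0` by
convention when no weak derivative exists). -/
def weakPartial (Ω : Set (Pt d)) (i : Fin d) (f : Pt d → ℝ) : Pt d → ℝ :=
  if h : ∃ g, HasWeakPartial Ω i f g then h.choose else 0

/-- `f ∈ H¹(Ω)`. -/
def MemH1 (Ω : Set (Pt d)) (f : Pt d → ℝ) : Prop :=
  MemLp f 2 (volume.restrict Ω) ∧
    ∀ i, (∃ g, HasWeakPartial Ω i f g) ∧ MemLp (weakPartial Ω i f) 2 (volume.restrict Ω)

/-- `f ∈ H²(Ω)`. -/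
def MemH2 (Ω : Set (Pt d)) (f : Pt d → ℝ) : Prop :=
  MemH1 Ω f ∧ ∀ i, MemH1 Ω (weakPartial Ω i f)

/-- `f ∈ H¹₀(Ω)`: `f` lies in the `H¹`-closure of the test functions (zero boundary values). -/
def MemH10 (Ω : Set (Pt d)) (f : Pt d → ℝ) : Prop :=
  MemH1 Ω f ∧ ∃ ψ : ℕ → Pt d → ℝ, (∀ k, IsTest Ω (ψ k)) ∧
    Tendsto (fun k => eLpNorm (ψ k - f) 2 (volume.restrict Ω)) atTop (𝓝 0) ∧
    ∀ i, Tendsto (fun k => eLpNorm (classicalPartial i (ψ k) - weakPartial Ω i f) 2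
      (volume.restrict Ω)) atTop (𝓝 0)

/-- A vector field with all components in `H²(Ω) ∩ H¹₀(Ω)`. -/
def VecMemH2H10 (Ω : Set (Pt d)) (v : Pt d → Pt d) : Prop :=
  ∀ j, MemH2 Ω (fun x => v x j) ∧ MemH10 Ω (fun x => v x j)

/-- The gradient `∇f`. -/
def grad (Ω : Set (Pt d)) (f : Pt d → ℝ) (x : Pt d) : Pt d :=
  WithLp.toLp 2 (fun i => weakPartial Ω i f x)

/-- The divergence `∇·w`. -/
def divergence (Ω : Set (Pt d)) (w : Pt d → Pt d) (x : Pt d) : ℝ :=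
  ∑ i, weakPartial Ω i (fun y => w y i) x

/-- The Laplacian `Δf = ∇·∇f`. -/
def lap (Ω : Set (Pt d)) (f : Pt d → ℝ) (x : Pt d) : ℝ :=
  divergence Ω (grad Ω f) x

/-- The componentwise Laplacian of a vector field. -/
def vecLap (Ω : Set (Pt d)) (v : Pt d → Pt d) (x : Pt d) : Pt d :=
  WithLp.toLp 2 (fun j => lap Ω (fun y => v y j) x)

/-- The convective term `(u·∇)v`. -/
def convect (Ω : Set (Pt d)) (u v : Pt d → Pt d) (x : Pt d) : Pt d :=
  WithLp.toLp 2 (fun j => ∑ i, u x i * weakPartial Ω i (fun y => v y j) x)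

/-- The scalar `L²(Ω)` inner product. -/
def ip (Ω : Set (Pt d)) (f g : Pt d → ℝ) : ℝ := ∫ x in Ω, f x * g x

/-- The vector `L²(Ω)` inner product. -/
def vip (Ω : Set (Pt d)) (v w : Pt d → Pt d) : ℝ := ∫ x in Ω, inner ℝ (v x) (w x)

/-- The trilinear form `b(u, v, w) = (u·∇v, w)`. -/
def trilinear (Ω : Set (Pt d)) (u v w : Pt d → Pt d) : ℝ := vip Ω (convect Ω u v) w

/-- `‖f‖²` for a scalar function. -/
def normSq (Ω : Set (Pt d)) (f : Pt d → ℝ) : ℝ := ∫ x in Ω, f x ^ 2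

/-- `‖v‖²` for a vector field. -/
def vnormSq (Ω : Set (Pt d)) (v : Pt d → Pt d) : ℝ := ∫ x in Ω, ‖v x‖ ^ 2

/-- `‖∇f‖²` for a scalar function. -/
def gradNormSq (Ω : Set (Pt d)) (f : Pt d → ℝ) : ℝ := vnormSq Ω (grad Ω f)

/-- `‖∇v‖²` for a vector field. -/
def vgradNormSq (Ω : Set (Pt d)) (v : Pt d → Pt d) : ℝ :=
  ∑ j, gradNormSq Ω (fun x => v x j)

/-- `∂ₙ f = 0` on `∂Ω` for `f ∈ H²(Ω)`: the normal trace of `∇f`, i.e. the functional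
`v ↦ ∫_Ω (Δf v + ∇f·∇v)` on `H¹(Ω)`, vanishes. -/
def ZeroNormalDeriv (Ω : Set (Pt d)) (f : Pt d → ℝ) : Prop :=
  ∀ v, MemH1 Ω v →
    ∫ x in Ω, (lap Ω f x * v x + inner ℝ (grad Ω f x) (grad Ω v x)) = 0

/-- Nonempty open bounded convex polygonal (`d = 2`) or polyhedral (`d = 3`) domains: interiors of
convex hulls of finitely many points. -/
def IsConvexPolytopalDomain (Ω : Set (Pt d)) : Prop :=
  Ω.Nonempty ∧ ∃ s : Finset (Pt d), Ω = interior (convexHull ℝ (s : Set (Pt d)))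

end Sobolev

/-! ### The model -/

/-- The physical and numerical parameters, all positive. -/
structure Params where
  /-- mobility -/
  M : ℝ
  /-- mixing coefficient -/
  lam : ℝ
  /-- viscosity -/
  nu : ℝ
  /-- interfacial width -/
  eps : ℝ
  /-- splitting parameter of the potential -/
  beta : ℝ
  /-- shift in the auxiliary variable -/
  delta0 : ℝ
  /-- artificial parameter of the velocity correction -/
  theta : ℝ
  M_pos : 0 < M
  lam_pos : 0 < lam
  nu_pos : 0 < nu
  eps_pos : 0 < eps
  beta_pos : 0 < beta
  delta0_pos : 0 < delta0
  theta_pos : 0 < theta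

/-- The Ginzburg--Landau potential `G(s) = (1 - s²)² / (4 ε²)`. -/
def Params.G (P : Params) (s : ℝ) : ℝ := (1 - s ^ 2) ^ 2 / (4 * P.eps ^ 2)

/-- `F(s) = G(s) - (β/2) s²`. -/
def Params.F (P : Params) (s : ℝ) : ℝ := P.G s - P.beta / 2 * s ^ 2

/-- `F'`. -/
def Params.F' (P : Params) (s : ℝ) : ℝ := deriv P.F s

variable {d : ℕ}

/-- `E₁(φ) = ∫_Ω F(φ)`. -/
def E1 (Ω : Set (Pt d)) (P : Params) (φ : Pt d → ℝ) : ℝ := ∫ x in Ω, P.F (φ x)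

/-- `√(E₁(φ) + δ₀)`. -/
def sqrtE1 (Ω : Set (Pt d)) (P : Params) (φ : Pt d → ℝ) : ℝ := √(E1 Ω P φ + P.delta0)

/-- The consistency parameter `γ = θ / (‖∇p‖ + 1)`. -/
def consistency (Ω : Set (Pt d)) (P : Params) (p : Pt d → ℝ) : ℝ :=
  P.theta / (√(gradNormSq Ω p) + 1)

/-- The discrete unknowns `(φ, μ, û, u, p, R)` at one time level. -/
structure State (d : ℕ) where
  phi : Pt d → ℝ
  mu : Pt d → ℝ
  uhat : Pt d → Pt d
  u : Pt d → Pt d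
  p : Pt d → ℝ
  R : ℝ

/-- Regularity and boundary conditions of the unknowns computed at a time level. -/
structure State.Admissible (Ω : Set (Pt d)) (s : State d) : Prop where
  phi_mem : MemH2 Ω s.phi
  phi_bc : ZeroNormalDeriv Ω s.phi
  mu_mem : MemH2 Ω s.mu
  mu_bc : ZeroNormalDeriv Ω s.mu
  uhat_mem : VecMemH2H10 Ω s.uhat
  u_mem : VecMemH2H10 Ω s.u
  p_mem : MemH1 Ω s.p

/-- The scalar auxiliary variable equation, common to both schemes: `dR` and `dphi` are the
discrete time derivatives of `R` and `φ`, `(φ, μ, u, p)` with parameter `γ` are the explicit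
quantities and `new` is the new time level. -/
def SAVEquation (Ω : Set (Pt d)) (P : Params) (dR : ℝ) (dphi : Pt d → ℝ)
    (φ μ : Pt d → ℝ) (u : Pt d → Pt d) (p : Pt d → ℝ) (γ : ℝ) (new : State d) : Prop :=
  dR = 1 / (2 * P.lam * sqrtE1 Ω P φ) *
        (P.lam * ip Ω (fun x => P.F' (φ x)) dphi
          + ip Ω new.mu (divergence Ω (fun x => φ x • u x)))
      + 1 / (2 * P.lam * sqrtE1 Ω P φ) *
        (vip Ω new.uhat (fun x => φ x • grad Ω μ x) + trilinear Ω u u new.uhat)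
      + γ / (2 * P.lam * sqrtE1 Ω P φ) * vip Ω (grad Ω p) new.uhat

/-- One step of the first-order scheme with step size `τ`, from level `old` to level `new`. -/
structure FirstOrderStep (Ω : Set (Pt d)) (P : Params) (τ : ℝ) (old new : State d) : Prop where
  admissible : new.Admissible Ω
  phi_eq : ∀ᵐ x ∂(volume.restrict Ω),
    (new.phi x - old.phi x) / τ
      + new.R / sqrtE1 Ω P old.phi * divergence Ω (fun y => old.phi y • old.u y) x
      = P.M * lap Ω new.mu x
  mu_eq : ∀ᵐ x ∂(volume.restrict Ω),
    new.mu x = - P.lam * lap Ω new.phi x + P.lam * P.beta * new.phi x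
      + P.lam * (new.R / sqrtE1 Ω P old.phi) * P.F' (old.phi x)
  uhat_eq : ∀ᵐ x ∂(volume.restrict Ω),
    (1 / τ) • (new.uhat x - old.u x)
      + (new.R / sqrtE1 Ω P old.phi) • convect Ω old.u old.u x
      - P.nu • vecLap Ω new.uhat x
      = - (new.R / sqrtE1 Ω P old.phi) •
          (old.phi x • grad Ω old.mu x + consistency Ω P old.p • grad Ω old.p x)
  R_eq : SAVEquation Ω P ((new.R - old.R) / τ) (fun x => (new.phi x - old.phi x) / τ)
    old.phi old.mu old.u old.p (consistency Ω P old.p) new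
  u_eq : ∀ᵐ x ∂(volume.restrict Ω),
    (1 / τ) • (new.u x - new.uhat x)
      - P.nu • vecLap Ω (fun y => new.u y - new.uhat y) x + grad Ω new.p x
      = consistency Ω P old.p • grad Ω old.p x
  div_eq : ∀ᵐ x ∂(volume.restrict Ω), divergence Ω new.u x = 0

/-- The extrapolation `2 w - w'`, for `w` at the current and `w'` at the previous time level. -/
def extrap {V : Type*} [AddCommGroup V] [Module ℝ V] (w' w : V) : V := (2 : ℝ) • w - w'

/-- The BDF2 difference quotient `(3 w⁺ - 4 w + w') / (2τ)`. -/
def bdf2 {V : Type*} [AddCommGroup V] [Module ℝ V] (τ : ℝ) (w' w wnew : V) : V :=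
  (1 / (2 * τ)) • ((3 : ℝ) • wnew - (4 : ℝ) • w + w')

/-- The scalar `ξ = R⁺ / √(E₁(φ*) + δ₀)` of the second-order scheme. -/
def xi2 (Ω : Set (Pt d)) (P : Params) (prev cur new : State d) : ℝ :=
  new.R / sqrtE1 Ω P (extrap prev.phi cur.phi)

/-- One step of the second-order (BDF2) scheme with step size `τ` and consistency parameter
`γ` (the value `γ*`), from levels `prev`, `cur` to level `new`. -/
structure BDF2Step (Ω : Set (Pt d)) (P : Params) (τ γ : ℝ) (prev cur new : State d) : Prop where
  admissible : new.Admissible Ω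
  phi_eq : ∀ᵐ x ∂(volume.restrict Ω),
    bdf2 τ prev.phi cur.phi new.phi x
      + xi2 Ω P prev cur new *
        divergence Ω (fun y => extrap prev.phi cur.phi y • extrap prev.u cur.u y) x
      = P.M * lap Ω new.mu x
  mu_eq : ∀ᵐ x ∂(volume.restrict Ω),
    new.mu x = - P.lam * lap Ω new.phi x + P.lam * P.beta * new.phi x
      + P.lam * xi2 Ω P prev cur new * P.F' (extrap prev.phi cur.phi x)
  uhat_eq : ∀ᵐ x ∂(volume.restrict Ω),
    bdf2 τ prev.u cur.u new.uhat x
      + xi2 Ω P prev cur new • convect Ω (extrap prev.u cur.u) (extrap prev.u cur.u) x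
      - P.nu • vecLap Ω new.uhat x
      = - xi2 Ω P prev cur new •
          (extrap prev.phi cur.phi x • grad Ω (extrap prev.mu cur.mu) x
            + γ • grad Ω (extrap prev.p cur.p) x)
  R_eq : SAVEquation Ω P (bdf2 τ prev.R cur.R new.R) (bdf2 τ prev.phi cur.phi new.phi)
    (extrap prev.phi cur.phi) (extrap prev.mu cur.mu) (extrap prev.u cur.u)
    (extrap prev.p cur.p) γ new
  u_eq : ∀ᵐ x ∂(volume.restrict Ω),
    (3 / (2 * τ)) • (new.u x - new.uhat x)
      - P.nu • vecLap Ω (fun y => new.u y - new.uhat y) x + grad Ω new.p x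
      = γ • grad Ω (extrap prev.p cur.p) x
  div_eq : ∀ᵐ x ∂(volume.restrict Ω), divergence Ω new.u x = 0

/-- Initial level: `φ⁰ ∈ H²`, `u⁰ ∈ H² ∩ H¹₀` divergence free, `μ⁰, p⁰ ∈ H¹`, and
`R⁰ = √(E₁(φ⁰) + δ₀)`. The component `uhat` of the initial level is never used. -/
structure InitialLevel (Ω : Set (Pt d)) (P : Params) (s : State d) : Prop where
  phi_mem : MemH2 Ω s.phi
  mu_mem : MemH1 Ω s.mu
  u_mem : VecMemH2H10 Ω s.u
  u_div : ∀ᵐ x ∂(volume.restrict Ω), divergence Ω s.u x = 0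
  p_mem : MemH1 Ω s.p
  R_eq : s.R = sqrtE1 Ω P s.phi

/-- `s 0, …, s Nt` is a solution of the second-order scheme with step size `τ`: level `1` is
computed by the first-order scheme, level `n + 1` for `n ≥ 1` by the BDF2 scheme. `γs n` is the
value of `γ*` in the step from levels `n - 1`, `n` to level `n + 1`. -/
structure IsSecondOrderSolution (Ω : Set (Pt d)) (P : Params) (τ : ℝ) (Nt : ℕ) (γs : ℕ → ℝ)
    (s : ℕ → State d) : Prop where
  initial : InitialLevel Ω P (s 0)
  first : FirstOrderStep Ω P τ (s 0) (s 1)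
  step : ∀ n, 1 ≤ n → n + 1 ≤ Nt → BDF2Step Ω P τ (γs n) (s (n - 1)) (s n) (s (n + 1))

/-- The modified energy of a pair of consecutive time levels, with `w* = 2 w - w'`. -/
def pairEnergy (Ω : Set (Pt d)) (P : Params) (τ : ℝ) (prev cur : State d) : ℝ :=
  1 / 4 * (vnormSq Ω cur.u + vnormSq Ω (extrap prev.u cur.u))
    + P.lam / 4 * (gradNormSq Ω cur.phi + gradNormSq Ω (extrap prev.phi cur.phi))
    + P.lam * P.beta / 4 * (normSq Ω cur.phi + normSq Ω (extrap prev.phi cur.phi))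
    + P.lam / 2 * (|cur.R| ^ 2 + |extrap prev.R cur.R| ^ 2)
    + P.nu * τ / 6 * vgradNormSq Ω cur.u

/-- The modified energy `Ẽⁿ`. It involves the levels `n` and `n - 1`; at `n = 0` the fictitious
level `-1` is taken equal to level `0`. -/
def modifiedEnergy (Ω : Set (Pt d)) (P : Params) (τ : ℝ) (s : ℕ → State d) : ℕ → ℝ
  | 0 => pairEnergy Ω P τ (s 0) (s 0)
  | n + 1 => pairEnergy Ω P τ (s n) (s (n + 1))

end CHNS

end

/-! Every nonlinear or explicit term of the scheme carries the factor `ξ`, and the equation for `R`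
is built to cancel these terms. Test the phase equation with the new `μ`, the potential equation
with the discrete derivative of `φ`, the momentum equation with the new `û`, and multiply the `R`
equation by `2 λ R`. Since `2 λ R / (2 λ √(E₁ + δ₀)) = ξ`, the transport, coupling, convection, `F'`
and `γ ∇p` terms all cancel, with no estimate. This is the identity `energy_balance`, valid for both
schemes; it leaves the dissipation and, for each of `∇φ`, `φ`, `R` and the velocity, a product of a
new value with a difference quotient.

For `∇φ`, `φ` and `R` such a product dominates an energy increment by `bdf2_inequality`. The
velocity is harder: its quotient contains `û`, which need not be divergence free, while the energy
contains `u`. Testing the velocity correction with the divergence free fields `uⁿ⁺¹` and `uⁿ`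
removes both pressures (`projection_balance`) and expresses the pairings of `uⁿ⁺¹ - ûⁿ⁺¹` with these
fields through gradients. Inserted into the BDF2 identity, they leave a quadratic form in gradients
that is nonnegative by completing squares; the energy term `ντ/6 ‖∇u‖²` pays for `∇uⁿ`
(`bdf2_velocity_inequality`).

With level `-1` equal to level `0`, the BDF2 quotient is `3/2` times the Euler quotient. Hence the
first step uses the same energy, with its balance multiplied by `3/2`.

Integrating the phase equation shows that the discrete derivative of `φ` has mean zero
(`integral_time_derivative_eq_zero`): the first step keeps the mass, and the BDF2 recurrence
propagates this.

The integrations by parts rest on the density of test functions in `H¹₀` or on the weak form of the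
Neumann condition. The convective form is integrable because `H¹₀ ⊂ L⁴`. The remaining algebra takes
place in the Hilbert space `L²`. -/

noncomputable section

namespace CHNS

variable {d : ℕ} {Ω : Set (Pt d)}

/-! ### Test functions -/

lemma IsTest.continuous {ψ : Pt d → ℝ} (h : IsTest Ω ψ) : Continuous ψ := h.1.continuous

lemma IsTest.differentiable {ψ : Pt d → ℝ} (h : IsTest Ω ψ) : Differentiable ℝ ψ :=
  h.1.differentiable (by simp)

lemma IsTest.contDiff_classicalPartial {ψ : Pt d → ℝ} (h : IsTest Ω ψ) (i : Fin d) :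
    ContDiff ℝ ∞ (classicalPartial i ψ) :=
  (h.1.fderiv_right (m := ∞) (by simp)).clm_apply contDiff_const

lemma IsTest.tsupport_classicalPartial {ψ : Pt d → ℝ} (i : Fin d) :
    tsupport (classicalPartial i ψ) ⊆ tsupport ψ :=
  tsupport_fderiv_apply_subset ℝ _

lemma IsTest.classicalPartial {ψ : Pt d → ℝ} (h : IsTest Ω ψ) (i : Fin d) :
    IsTest Ω (classicalPartial i ψ) :=
  ⟨h.contDiff_classicalPartial i,
    h.2.1.of_isClosed_subset (isClosed_tsupport _) (IsTest.tsupport_classicalPartial i),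
    (IsTest.tsupport_classicalPartial i).trans h.2.2⟩

lemma IsTest.mul {ψ η : Pt d → ℝ} (h : IsTest Ω ψ) (h' : IsTest Ω η) :
    IsTest Ω (fun x => ψ x * η x) :=
  ⟨h.1.mul h'.1, h.2.1.mul_right, (tsupport_mul_subset_left).trans h.2.2⟩

lemma IsTest.lincomb {ψ η : Pt d → ℝ} (h : IsTest Ω ψ) (h' : IsTest Ω η) (a b : ℝ) :
    IsTest Ω (fun x => a * ψ x + b * η x) := by
  refine ⟨(contDiff_const.mul h.1).add (contDiff_const.mul h'.1),
    (h.2.1.mul_left).add (h'.2.1.mul_left), ?_⟩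
  refine (tsupport_add _ _).trans (Set.union_subset ?_ ?_)
  · exact (tsupport_mul_subset_right).trans h.2.2
  · exact (tsupport_mul_subset_right).trans h'.2.2

lemma classicalPartial_lincomb {ψ η : Pt d → ℝ} (h : IsTest Ω ψ) (h' : IsTest Ω η) (a b : ℝ)
    (i : Fin d) (x : Pt d) :
    classicalPartial i (fun x => a * ψ x + b * η x) x
      = a * classicalPartial i ψ x + b * classicalPartial i η x := by
  have h1 := h.differentiable x
  have h2 := h'.differentiable x
  simp only [CHNS.classicalPartial]
  rw [fderiv_fun_add (h1.const_mul a) (h2.const_mul b), fderiv_const_mul h1, fderiv_const_mul h2]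
  simp

lemma classicalPartial_mul {ψ η : Pt d → ℝ} (h : IsTest Ω ψ) (h' : IsTest Ω η)
    (i : Fin d) (x : Pt d) :
    classicalPartial i (fun x => ψ x * η x) x
      = ψ x * classicalPartial i η x + η x * classicalPartial i ψ x := by
  have h1 := h.differentiable x
  have h2 := h'.differentiable x
  simp only [CHNS.classicalPartial]
  rw [fderiv_fun_mul h1 h2]
  simp

lemma IsTest.exists_bound {ψ : Pt d → ℝ} (h : IsTest Ω ψ) : ∃ C, ∀ x, ‖ψ x‖ ≤ C :=
  h.2.1.exists_bound_of_continuous h.continuous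

lemma IsTest.memLp {ψ : Pt d → ℝ} (h : IsTest Ω ψ) (p : ENNReal) :
    MemLp ψ p (volume.restrict Ω) :=
  (h.continuous.memLp_of_hasCompactSupport h.2.1).restrict Ω

/-- The product vanishes off the compact set `tsupport ψ ⊆ Ω`, where `f` is integrable and `ψ` is
bounded. -/
lemma IsTest.integrable_mul {ψ f : Pt d → ℝ} (h : IsTest Ω ψ) (hf : LocallyIntegrableOn f Ω) :
    IntegrableOn (fun x => f x * ψ x) Ω := by
  have hK : IntegrableOn f (tsupport ψ) :=
    hf.integrableOn_compact_subset h.2.2 h.2.1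
  obtain ⟨C, hC⟩ := h.exists_bound
  have h1 : IntegrableOn (fun x => f x * ψ x) (tsupport ψ) :=
    Integrable.mul_bdd (c := C) hK h.continuous.aestronglyMeasurable
      (Eventually.of_forall hC)
  refine (h1.of_forall_sdiff_eq_zero MeasurableSet.univ ?_).mono_set (Set.subset_univ Ω)
  intro x hx
  rw [image_eq_zero_of_notMem_tsupport hx.2, mul_zero]

/-! ### Weak derivatives -/

/-- Fundamental lemma of the calculus of variations applied to `g - g'`. It makes the choice in
`weakPartial` harmless, but only almost everywhere. -/
lemma HasWeakPartial.unique (hΩ : IsOpen Ω) {i : Fin d} {f g g' : Pt d → ℝ}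
    (h : HasWeakPartial Ω i f g) (h' : HasWeakPartial Ω i f g') :
    g =ᵐ[volume.restrict Ω] g' := by
  have key : ∀ᵐ x ∂(volume : Measure (Pt d)), x ∈ Ω → (g - g') x = 0 := by
    refine hΩ.ae_eq_zero_of_integral_contDiff_smul_eq_zero (h.2.1.sub h'.2.1) ?_
    intro ψ h1 h2 h3
    have ht : IsTest Ω ψ := ⟨h1, h2, h3⟩
    have e : ∫ x in Ω, (g x * ψ x - g' x * ψ x) = 0 := by
      rw [integral_sub (ht.integrable_mul h.2.1) (ht.integrable_mul h'.2.1)]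
      have e1 := h.2.2 ψ ht
      have e2 := h'.2.2 ψ ht
      linarith
    rw [← e, ← setIntegral_eq_integral_of_forall_compl_eq_zero (s := Ω)]
    · refine integral_congr_ae (Eventually.of_forall fun x => ?_)
      simp only [Pi.sub_apply, smul_eq_mul]
      ring
    · intro x hx
      rw [image_eq_zero_of_notMem_tsupport (fun hx' => hx (h3 hx')), zero_smul]
  filter_upwards [(ae_restrict_iff' hΩ.measurableSet).2 key] with x hx
  exact sub_eq_zero.1 hx

lemma hasWeakPartial_weakPartial {i : Fin d} {f : Pt d → ℝ} (h : ∃ g, HasWeakPartial Ω i f g) :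
    HasWeakPartial Ω i f (weakPartial Ω i f) := by
  rw [weakPartial, dif_pos h]
  exact h.choose_spec

lemma HasWeakPartial.weakPartial_ae_eq (hΩ : IsOpen Ω) {i : Fin d} {f g : Pt d → ℝ}
    (h : HasWeakPartial Ω i f g) : weakPartial Ω i f =ᵐ[volume.restrict Ω] g :=
  (hasWeakPartial_weakPartial ⟨g, h⟩).unique hΩ h

/-- A weak derivative only depends on the almost everywhere class of the function. -/
lemma HasWeakPartial.congr {i : Fin d} {f f' g g' : Pt d → ℝ} 
    (h : HasWeakPartial Ω i f g) (hf : f =ᵐ[volume.restrict Ω] f')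
    (hg : g =ᵐ[volume.restrict Ω] g') : HasWeakPartial Ω i f' g' := by
  refine ⟨h.1.congr hf, h.2.1.congr hg, fun ψ hψ => ?_⟩
  rw [integral_congr_ae (g := fun x => f x * CHNS.classicalPartial i ψ x),
    integral_congr_ae (f := fun x => g' x * ψ x) (g := fun x => g x * ψ x), h.2.2 ψ hψ]
  · filter_upwards [hg] with x hx
    rw [hx]
  · filter_upwards [hf] with x hx
    rw [hx]

lemma HasWeakPartial.lincomb {i : Fin d} {f f' g g' : Pt d → ℝ}
    (h : HasWeakPartial Ω i f g) (h' : HasWeakPartial Ω i f' g') (a b : ℝ) :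
    HasWeakPartial Ω i (fun x => a * f x + b * f' x) (fun x => a * g x + b * g' x) := by
  refine ⟨(h.1.smul a).add (h'.1.smul b), (h.2.1.smul a).add (h'.2.1.smul b), fun ψ hψ => ?_⟩
  have e : ∀ {u v η : Pt d → ℝ}, LocallyIntegrableOn u Ω → LocallyIntegrableOn v Ω →
      IsTest Ω η → ∫ x in Ω, (a * u x + b * v x) * η x
        = a * (∫ x in Ω, u x * η x) + b * (∫ x in Ω, v x * η x) := by
    intro u v η hu hv hη
    rw [← integral_const_mul, ← integral_const_mul,
      ← integral_add ((hη.integrable_mul hu).const_mul a) ((hη.integrable_mul hv).const_mul b)]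
    exact integral_congr_ae (Eventually.of_forall fun x => by ring)
  rw [e h.1 h'.1 (hψ.classicalPartial i), e h.2.1 h'.2.1 hψ, h.2.2 ψ hψ, h'.2.2 ψ hψ]
  ring

lemma hasWeakPartial_const (hfin : volume Ω ≠ ⊤) (i : Fin d) (c : ℝ) :
    HasWeakPartial Ω i (fun _ => c) (fun _ => 0) := by
  refine ⟨(integrableOn_const hfin).locallyIntegrableOn, integrableOn_zero.locallyIntegrableOn,
    fun ψ hψ => ?_⟩
  have h0 : ∫ x, classicalPartial i ψ x = 0 := by
    have h1 : Integrable (classicalPartial i ψ) :=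
      (hψ.classicalPartial i).continuous.integrable_of_hasCompactSupport
        (hψ.classicalPartial i).2.1
    have h2 : Integrable ψ := hψ.continuous.integrable_of_hasCompactSupport hψ.2.1
    have := integral_mul_fderiv_eq_neg_fderiv_mul_of_integrable (𝕜 := ℝ)
      (μ := (volume : Measure (Pt d))) (f := fun _ => (1 : ℝ)) (g := ψ)
      (v := EuclideanSpace.single i 1) (by simp) (by simp only [one_mul]; exact h1)
      (by simp only [one_mul]; exact h2) (fun x _ => by fun_prop) (fun x _ => hψ.differentiable x)
    simp only [one_mul, fderiv_fun_const, Pi.zero_apply, zero_apply, zero_mul,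
      integral_zero, neg_zero] at this
    exact this
  rw [integral_const_mul, setIntegral_eq_integral_of_forall_compl_eq_zero, h0]
  · simp
  · intro x hx
    exact image_eq_zero_of_notMem_tsupport fun hx' => hx ((hψ.classicalPartial i).2.2 hx')

/-! ### The spaces `H¹`, `H²` and `H¹₀` -/

lemma MemH1.hasWeakPartial {f : Pt d → ℝ} (h : MemH1 Ω f) (i : Fin d) :
    HasWeakPartial Ω i f (weakPartial Ω i f) := hasWeakPartial_weakPartial (h.2 i).1

lemma MemH1.of_hasWeakPartial (hΩ : IsOpen Ω) {f : Pt d → ℝ} {g : Fin d → Pt d → ℝ}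
    (hf : MemLp f 2 (volume.restrict Ω)) (h : ∀ i, HasWeakPartial Ω i f (g i))
    (hg : ∀ i, MemLp (g i) 2 (volume.restrict Ω)) : MemH1 Ω f :=
  ⟨hf, fun i => ⟨⟨g i, h i⟩, (hg i).ae_eq ((h i).weakPartial_ae_eq hΩ).symm⟩⟩

/-- Needed for `MemH2`: the chosen weak derivative of a combination agrees with the combination of
weak derivatives only almost everywhere. -/
lemma MemH1.congr (hΩ : IsOpen Ω) {f f' : Pt d → ℝ} (h : MemH1 Ω f)
    (hf : f =ᵐ[volume.restrict Ω] f') : MemH1 Ω f' :=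
  MemH1.of_hasWeakPartial hΩ (h.1.ae_eq hf)
    (fun i => (h.hasWeakPartial i).congr hf EventuallyEq.rfl) fun i => (h.2 i).2

lemma memH1_const (hΩ : IsOpen Ω) (hfin : volume Ω ≠ ⊤) (c : ℝ) :
    MemH1 Ω (fun _ => c) := by
  have : IsFiniteMeasure (volume.restrict Ω) := isFiniteMeasure_restrict.2 hfin
  exact MemH1.of_hasWeakPartial hΩ (memLp_const c) (fun i => hasWeakPartial_const hfin i c)
    fun i => memLp_const 0

lemma weakPartial_const (hΩ : IsOpen Ω) (hfin : volume Ω ≠ ⊤) (i : Fin d) (c : ℝ) :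
    weakPartial Ω i (fun _ => c) =ᵐ[volume.restrict Ω] fun _ => 0 :=
  (hasWeakPartial_const hfin i c).weakPartial_ae_eq hΩ

lemma weakPartial_lincomb (hΩ : IsOpen Ω) {f g : Pt d → ℝ} (hf : MemH1 Ω f) (hg : MemH1 Ω g)
    (a b : ℝ) (i : Fin d) :
    weakPartial Ω i (fun x => a * f x + b * g x) =ᵐ[volume.restrict Ω]
      fun x => a * weakPartial Ω i f x + b * weakPartial Ω i g x :=
  ((hf.hasWeakPartial i).lincomb (hg.hasWeakPartial i) a b).weakPartial_ae_eq hΩ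

lemma MemH1.lincomb (hΩ : IsOpen Ω) {f g : Pt d → ℝ} (hf : MemH1 Ω f) (hg : MemH1 Ω g)
    (a b : ℝ) : MemH1 Ω (fun x => a * f x + b * g x) :=
  MemH1.of_hasWeakPartial hΩ ((hf.1.const_mul a).add (hg.1.const_mul b))
    (fun i => (hf.hasWeakPartial i).lincomb (hg.hasWeakPartial i) a b)
    fun i => ((hf.2 i).2.const_mul a).add ((hg.2 i).2.const_mul b)

lemma MemH2.lincomb (hΩ : IsOpen Ω) {f g : Pt d → ℝ} (hf : MemH2 Ω f) (hg : MemH2 Ω g)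
    (a b : ℝ) : MemH2 Ω (fun x => a * f x + b * g x) :=
  ⟨hf.1.lincomb hΩ hg.1 a b, fun i => ((hf.2 i).lincomb hΩ (hg.2 i) a b).congr hΩ
    (weakPartial_lincomb hΩ hf.1 hg.1 a b i).symm⟩

lemma tendsto_eLpNorm_lincomb {f g : Pt d → ℝ} {F G : ℕ → Pt d → ℝ} {μ : Measure (Pt d)}
    (hF : Tendsto (fun k => eLpNorm (F k - f) 2 μ) atTop (𝓝 0))
    (hG : Tendsto (fun k => eLpNorm (G k - g) 2 μ) atTop (𝓝 0))
    (hFm : ∀ k, AEStronglyMeasurable (F k - f) μ) (hGm : ∀ k, AEStronglyMeasurable (G k - g) μ)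
    (a b : ℝ) {h : Pt d → ℝ} (hh : h =ᵐ[μ] fun x => a * f x + b * g x) :
    Tendsto (fun k => eLpNorm ((fun x => a * F k x + b * G k x) - h) 2 μ) atTop (𝓝 0) := by
  have lim : Tendsto (fun k => ‖a‖ₑ * eLpNorm (F k - f) 2 μ + ‖b‖ₑ * eLpNorm (G k - g) 2 μ)
      atTop (𝓝 0) := by
    simpa using (ENNReal.Tendsto.const_mul hF (Or.inr enorm_ne_top)).add
      (ENNReal.Tendsto.const_mul hG (Or.inr enorm_ne_top))
  refine tendsto_of_tendsto_of_tendsto_of_le_of_le tendsto_const_nhds lim (fun _ => zero_le)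
    fun k => ?_
  have e : ((fun x => a * F k x + b * G k x) - h) =ᵐ[μ] a • (F k - f) + b • (G k - g) := by
    filter_upwards [hh] with x hx
    simp only [Pi.sub_apply, hx, Pi.add_apply, Pi.smul_apply, smul_eq_mul]
    ring
  rw [eLpNorm_congr_ae e]
  refine (eLpNorm_add_le ((hFm k).const_smul a) ((hGm k).const_smul b) one_le_two).trans ?_
  exact add_le_add eLpNorm_const_smul_le eLpNorm_const_smul_le

lemma MemH10.lincomb (hΩ : IsOpen Ω) {f g : Pt d → ℝ} (hf : MemH10 Ω f) (hg : MemH10 Ω g)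
    (a b : ℝ) : MemH10 Ω (fun x => a * f x + b * g x) := by
  obtain ⟨hf1, F, hF, hF0, hFi⟩ := hf
  obtain ⟨hg1, G, hG, hG0, hGi⟩ := hg
  refine ⟨hf1.lincomb hΩ hg1 a b, fun k x => a * F k x + b * G k x,
    fun k => (hF k).lincomb (hG k) a b, ?_, fun i => ?_⟩
  · exact tendsto_eLpNorm_lincomb hF0 hG0
      (fun k => (((hF k).memLp 2).sub hf1.1).1) (fun k => (((hG k).memLp 2).sub hg1.1).1) a b
      EventuallyEq.rfl
  · have e : ∀ k, classicalPartial i (fun x => a * F k x + b * G k x) =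
        fun x => a * classicalPartial i (F k) x + b * classicalPartial i (G k) x := fun k =>
      funext fun x => classicalPartial_lincomb (hF k) (hG k) a b i x
    simp only [e]
    exact tendsto_eLpNorm_lincomb (hFi i) (hGi i)
      (fun k => ((((hF k).classicalPartial i).memLp 2).sub (hf1.2 i).2).1)
      (fun k => ((((hG k).classicalPartial i).memLp 2).sub (hg1.2 i).2).1) a b
      (weakPartial_lincomb hΩ hf1 hg1 a b i)

lemma integrable_mul_of_memLp_two {f g : Pt d → ℝ} {μ : Measure (Pt d)} (hf : MemLp f 2 μ)
    (hg : MemLp g 2 μ) : Integrable (fun x => f x * g x) μ :=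
  hf.integrable_mul hg

/-- By Hölder, `L²` convergence of one factor against a fixed `L²` function is `L¹` convergence of
the product. This is how identities pass from test functions to `H¹₀`. -/
lemma tendsto_integral_mul {f g : Pt d → ℝ} {F : ℕ → Pt d → ℝ} {μ : Measure (Pt d)}
    (hF : Tendsto (fun k => eLpNorm (F k - f) 2 μ) atTop (𝓝 0))
    (hFm : ∀ k, MemLp (F k) 2 μ) (hf : MemLp f 2 μ) (hg : MemLp g 2 μ) :
    Tendsto (fun k => ∫ x, F k x * g x ∂μ) atTop (𝓝 (∫ x, f x * g x ∂μ)) := by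
  refine tendsto_integral_of_L1' _ (integrable_mul_of_memLp_two hf hg).1
    (Eventually.of_forall fun k => integrable_mul_of_memLp_two (hFm k) hg) ?_
  have lim : Tendsto (fun k => eLpNorm (F k - f) 2 μ * eLpNorm g 2 μ) atTop (𝓝 0) := by
    simpa using ENNReal.Tendsto.mul_const hF (Or.inr hg.2.ne)
  refine tendsto_of_tendsto_of_tendsto_of_le_of_le tendsto_const_nhds lim (fun _ => zero_le)
    fun k => ?_
  have e : (fun x => F k x * g x) - (fun x => f x * g x) = (F k - f) • g := by
    ext x
    simp [sub_mul]
  simp only [e]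
  exact eLpNorm_smul_le_mul_eLpNorm hg.1 ((hFm k).sub hf).1

/-- Integration by parts for `f ∈ H¹₀` and `g ∈ H¹`. -/
lemma MemH10.integral_mul_weakPartial {f g : Pt d → ℝ} (hf : MemH10 Ω f) (hg : MemH1 Ω g)
    (i : Fin d) :
    ∫ x in Ω, f x * weakPartial Ω i g x = - ∫ x in Ω, weakPartial Ω i f x * g x := by
  obtain ⟨hf1, F, hF, hF0, hFi⟩ := hf
  have l1 := tendsto_integral_mul hF0 (fun k => (hF k).memLp 2) hf1.1 (hg.2 i).2
  have l2 := tendsto_integral_mul (hFi i) (fun k => ((hF k).classicalPartial i).memLp 2)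
    (hf1.2 i).2 hg.1
  refine tendsto_nhds_unique l1 (l2.neg.congr fun k => ?_)
  have := (hg.hasWeakPartial i).2.2 _ (hF k)
  rw [neg_eq_iff_eq_neg]
  simpa only [mul_comm] using this

/-- Product rule for `f ∈ H¹₀` and `g ∈ H¹`. -/
lemma MemH10.hasWeakPartial_mul {f g : Pt d → ℝ} (hf : MemH10 Ω f) (hg : MemH1 Ω g)
    (i : Fin d) :
    HasWeakPartial Ω i (fun x => g x * f x)
      (fun x => g x * weakPartial Ω i f x + weakPartial Ω i g x * f x) := by
  obtain ⟨hf1, F, hF, hF0, hFi⟩ := hf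
  have i1 := integrable_mul_of_memLp_two hg.1 hf1.1
  have i2 := integrable_mul_of_memLp_two hg.1 (hf1.2 i).2
  have i3 := integrable_mul_of_memLp_two (hg.2 i).2 hf1.1
  refine ⟨IntegrableOn.locallyIntegrableOn i1, IntegrableOn.locallyIntegrableOn (i2.add i3),
    fun ψ hψ => ?_⟩
  have hb : ∀ {h η : Pt d → ℝ}, IsTest Ω η → MemLp h 2 (volume.restrict Ω) →
      MemLp (fun x => h x * η x) 2 (volume.restrict Ω) := fun {h η} hη hh =>
    MemLp.mul' (p := 2) (q := ⊤) (r := 2) (hη.memLp ⊤) hh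
  have l1 := tendsto_integral_mul hF0 (fun k => (hF k).memLp 2) hf1.1
    (hb (hψ.classicalPartial i) hg.1)
  have l2 := tendsto_integral_mul (hFi i) (fun k => ((hF k).classicalPartial i).memLp 2)
    (hf1.2 i).2 (hb hψ hg.1)
  have l3 := tendsto_integral_mul hF0 (fun k => (hF k).memLp 2) hf1.1 (hb hψ (hg.2 i).2)
  have key : ∫ x in Ω, f x * (g x * classicalPartial i ψ x)
      = - ((∫ x in Ω, weakPartial Ω i f x * (g x * ψ x))
        + (∫ x in Ω, f x * (weakPartial Ω i g x * ψ x))) := by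
    -- With `F k` in place of `f`, the identity is the definition of the weak derivative of `g`
    -- tested with `F k * ψ`.
    refine tendsto_nhds_unique l1 ((l2.add l3).neg.congr fun k => ?_)
    have h := (hg.hasWeakPartial i).2.2 _ ((hF k).mul hψ)
    simp only [classicalPartial_mul (hF k) hψ] at h
    have j1 := integrable_mul_of_memLp_two ((hF k).memLp 2) (hb (hψ.classicalPartial i) hg.1)
    have j2 := integrable_mul_of_memLp_two (((hF k).classicalPartial i).memLp 2) (hb hψ hg.1)
    have e1 : ∫ x in Ω, g x * (F k x * classicalPartial i ψ x + ψ x * classicalPartial i (F k) x)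
        = (∫ x in Ω, F k x * (g x * classicalPartial i ψ x))
          + (∫ x in Ω, classicalPartial i (F k) x * (g x * ψ x)) := by
      rw [← integral_add j1 j2]
      exact integral_congr_ae (Eventually.of_forall fun x => by ring)
    have e2 : ∫ x in Ω, weakPartial Ω i g x * (F k x * ψ x)
        = ∫ x in Ω, F k x * (weakPartial Ω i g x * ψ x) :=
      integral_congr_ae (Eventually.of_forall fun x => by ring)
    rw [e1, e2] at h
    linarith
  have e3 : ∫ x in Ω, g x * f x * classicalPartial i ψ x
      = ∫ x in Ω, f x * (g x * classicalPartial i ψ x) :=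
    integral_congr_ae (Eventually.of_forall fun x => by ring)
  rw [e3, key, ← integral_add (integrable_mul_of_memLp_two (hf1.2 i).2 (hb hψ hg.1))
    (integrable_mul_of_memLp_two hf1.1 (hb hψ (hg.2 i).2))]
  exact congrArg Neg.neg (integral_congr_ae (Eventually.of_forall fun x => by ring))

/-- The Sobolev embedding `H¹₀(Ω) ⊂ L⁴(Ω)` on bounded sets in dimensions two and three. -/
lemma MemH10.memLp_four (hd : d = 2 ∨ d = 3) (hb : Bornology.IsBounded Ω)
    {f : Pt d → ℝ} (hf : MemH10 Ω f) : MemLp f 4 (volume.restrict Ω) := by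
  obtain ⟨hf1, F, hF, hF0, hFi⟩ := hf
  have hfin : IsFiniteMeasure (volume.restrict Ω) := isFiniteMeasure_restrict.2 hb.measure_lt_top.ne
  let D : ℕ → ENNReal := fun k => ∑ i, eLpNorm (classicalPartial i (F k)) 2 (volume.restrict Ω)
  let B : ENNReal := ∑ i, (1 + eLpNorm (weakPartial Ω i f) 2 (volume.restrict Ω))
  have hB : B ≠ ⊤ := ENNReal.sum_ne_top.2 fun i _ =>
    ENNReal.add_ne_top.2 ⟨ENNReal.one_ne_top, (hf1.2 i).2.2.ne⟩
  have hD : ∀ᶠ k in atTop, D k ≤ B := by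
    have h1 : ∀ᶠ k in atTop, ∀ i,
        eLpNorm (classicalPartial i (F k) - weakPartial Ω i f) 2 (volume.restrict Ω) ≤ 1 :=
      eventually_all.2 fun i => (hFi i).eventually_le_const one_pos
    filter_upwards [h1] with k hk
    refine Finset.sum_le_sum fun i _ => ?_
    have e : classicalPartial i (F k)
        = (classicalPartial i (F k) - weakPartial Ω i f) + weakPartial Ω i f := by simp
    have m := ((hF k).classicalPartial i).memLp (Ω := Ω) 2
    rw [e]
    exact (eLpNorm_add_le (m.sub (hf1.2 i).2).1 (hf1.2 i).2.1 one_le_two).trans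
      (add_le_add_left (hk i) _)
  have hgrad : ∀ k, eLpNorm (fderiv ℝ (F k)) 2 volume ≤ D k := by
    intro k
    have hsupp : ∀ i, Function.support (classicalPartial i (F k)) ⊆ Ω := fun i =>
      (subset_tsupport _).trans ((hF k).classicalPartial i).2.2
    have hn : ∀ x, ‖fderiv ℝ (F k) x‖ ≤ ∑ i, ‖classicalPartial i (F k) x‖ := by
      intro x
      refine ContinuousLinearMap.opNorm_le_bound _ (Finset.sum_nonneg fun i _ => norm_nonneg _)
        fun v => ?_
      have hv : v = ∑ i, v i • EuclideanSpace.single i (1 : ℝ) := by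
        ext j
        simp [Finset.sum_apply, Pi.single_apply]
      conv_lhs => rw [hv]
      rw [map_sum, Finset.sum_mul]
      refine (norm_sum_le _ _).trans (Finset.sum_le_sum fun i _ => ?_)
      rw [map_smul, norm_smul, mul_comm]
      exact mul_le_mul_of_nonneg_left (PiLp.norm_apply_le v i) (norm_nonneg _)
    have h2 : eLpNorm (fderiv ℝ (F k)) 2 volume
        ≤ eLpNorm (∑ i, fun x => ‖classicalPartial i (F k) x‖) 2 volume :=
      eLpNorm_mono_real fun x => by simpa only [Finset.sum_apply] using hn x
    refine h2.trans ((eLpNorm_sum_le (fun i _ =>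
      ((hF k).classicalPartial i).continuous.norm.aestronglyMeasurable) one_le_two).trans ?_)
    refine Finset.sum_le_sum fun i _ => ?_
    rw [eLpNorm_norm, eLpNorm_restrict_eq_of_support_subset (hsupp i)]
  -- The Gagliardo–Nirenberg–Sobolev inequality with target exponent `4` needs `p < d` and `1/p -
  -- 1/d ≤ 1/4`. The value `12/7` gives equality for `d = 3` and also works for `d = 2`, where `p =
  -- 2` is excluded. As `p ≤ 2` and `Ω` has finite measure, the `L²` bound on gradients suffices.
  let p : NNReal := 12 / 7
  let C : ENNReal := eLpNormLESNormFDerivOfLeConst ℝ (volume : Measure (Pt d)) Ω p 4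
  have hp : (p : ℝ) = 12 / 7 := by simp [p]
  have hS : ∀ k, eLpNorm (F k) 4 (volume.restrict Ω)
      ≤ C * (D k * volume Ω ^ (1 / (p : ENNReal).toReal - 1 / (2 : ENNReal).toReal)) := by
    intro k
    have hsupp : Function.support (F k) ⊆ Ω := (subset_tsupport _).trans (hF k).2.2
    have hsupp' : Function.support (fderiv ℝ (F k)) ⊆ Ω :=
      (support_fderiv_subset ℝ).trans (hF k).2.2
    have hr : ∀ q, eLpNorm (fderiv ℝ (F k)) q (volume.restrict Ω)
        = eLpNorm (fderiv ℝ (F k)) q volume := fun q => by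
      rw [← eLpNorm_norm, ← eLpNorm_norm (μ := volume)]
      refine eLpNorm_restrict_eq_of_support_subset fun x hx => ?_
      by_contra h
      exact hx (norm_eq_zero.2 (Function.notMem_support.1 fun h' => h (hsupp' h')))
    have h1 := eLpNorm_le_eLpNorm_fderiv_of_le (volume : Measure (Pt d)) (u := F k) (s := Ω)
      (p := p) (q := 4) ((hF k).1.of_le (by simp)) hsupp
      (by rw [← NNReal.coe_le_coe, hp]; norm_num)
      (by rw [← NNReal.coe_lt_coe, hp]; rcases hd with rfl | rfl <;> simp <;> norm_num)
      (by rw [NNReal.coe_inv, hp]; rcases hd with rfl | rfl <;> simp <;> norm_num) hb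
    rw [eLpNorm_restrict_eq_of_support_subset hsupp]
    refine h1.trans (mul_le_mul_right ?_ _)
    rw [← hr]
    have h2 := eLpNorm_le_eLpNorm_mul_rpow_measure_univ (μ := volume.restrict Ω)
      (f := fderiv ℝ (F k)) (p := p) (q := 2)
      (by rw [← ENNReal.coe_ofNat, ENNReal.coe_le_coe, ← NNReal.coe_le_coe, hp]; norm_num)
      ((hF k).1.continuous_fderiv (by simp)).aestronglyMeasurable
    refine h2.trans ?_
    rw [Measure.restrict_apply_univ, hr]
    exact mul_le_mul_left (hgrad k) _
  -- The `L⁴` norm is lower semicontinuous under convergence in measure, so the eventual uniform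
  -- bound passes to the limit `f`.
  refine ⟨hf1.1.1, lt_of_le_of_lt (eLpNorm_le_of_tendstoInMeasure
    (C := C * (B * volume Ω ^ (1 / (p : ENNReal).toReal - 1 / (2 : ENNReal).toReal)))
    (hD.mono fun k hk => (hS k).trans (by gcongr))
    (tendstoInMeasure_of_tendsto_eLpNorm two_ne_zero
      (fun k => (hF k).continuous.aestronglyMeasurable) hf1.1.1 hF0)
    fun k => (hF k).continuous.aestronglyMeasurable) ?_⟩
  refine (ENNReal.mul_ne_top ENNReal.coe_ne_top (ENNReal.mul_ne_top hB ?_)).lt_top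
  refine ENNReal.rpow_ne_top_of_nonneg ?_ hb.measure_lt_top.ne
  rw [ENNReal.coe_toReal, hp]
  norm_num

/-! ### Square integrable fields -/

section Lift

variable {α E : Type*} [MeasurableSpace α] [NormedAddCommGroup E]
  {μ : Measure α}

open Classical in
/-- The class of `f` in `L²`, or `0` if `f` is not square integrable. -/
def liftL2 (μ : Measure α) (f : α → E) : Lp E 2 μ :=
  if h : MemLp f 2 μ then h.toLp f else 0

lemma liftL2_of_memLp {f : α → E} (h : MemLp f 2 μ) : liftL2 μ f = h.toLp f := dif_pos h

lemma coeFn_liftL2 {f : α → E} (h : MemLp f 2 μ) : liftL2 μ f =ᵐ[μ] f := by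
  rw [liftL2_of_memLp h]
  exact h.coeFn_toLp

variable [InnerProductSpace ℝ E]

/-- The almost everywhere hypothesis is what weak gradients provide: they are linear only up to null
sets, and become truly linear in `L²`. -/
lemma liftL2_lincomb {f g k : α → E} (hf : MemLp f 2 μ) (hg : MemLp g 2 μ) {a b : ℝ}
    (hk : k =ᵐ[μ] fun x => a • f x + b • g x) :
    liftL2 μ k = a • liftL2 μ f + b • liftL2 μ g := by
  have hm : MemLp (a • f + b • g) 2 μ := (hf.const_smul a).add (hg.const_smul b)
  have hk' : MemLp k 2 μ := hm.ae_eq hk.symm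
  rw [liftL2_of_memLp hk', liftL2_of_memLp hf, liftL2_of_memLp hg, ← MemLp.toLp_const_smul,
    ← MemLp.toLp_const_smul, ← MemLp.toLp_add, MemLp.toLp_eq_toLp_iff]
  exact hk

lemma integrable_inner_of_memLp {f g : α → E} (hf : MemLp f 2 μ) (hg : MemLp g 2 μ) :
    Integrable (fun x => inner ℝ (f x) (g x)) μ := by
  refine (L2.integrable_inner (𝕜 := ℝ) (liftL2 μ f) (liftL2 μ g)).congr ?_
  filter_upwards [coeFn_liftL2 hf, coeFn_liftL2 hg] with x h1 h2
  rw [h1, h2]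

lemma integral_inner_eq {f g : α → E} (hf : MemLp f 2 μ) (hg : MemLp g 2 μ) :
    ∫ x, inner ℝ (f x) (g x) ∂μ = inner ℝ (liftL2 μ f) (liftL2 μ g) := by
  rw [L2.inner_def]
  refine integral_congr_ae ?_
  filter_upwards [coeFn_liftL2 hf, coeFn_liftL2 hg] with x h1 h2
  rw [h1, h2]

lemma integral_norm_sq_eq {f : α → E} (hf : MemLp f 2 μ) :
    ∫ x, ‖f x‖ ^ 2 ∂μ = ‖liftL2 μ f‖ ^ 2 := by
  rw [← real_inner_self_eq_norm_sq, ← integral_inner_eq hf hf]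
  simp only [real_inner_self_eq_norm_sq]

end Lift

lemma ip_eq_inner {f g : Pt d → ℝ} (hf : MemLp f 2 (volume.restrict Ω))
    (hg : MemLp g 2 (volume.restrict Ω)) :
    ip Ω f g = inner ℝ (liftL2 (volume.restrict Ω) f) (liftL2 (volume.restrict Ω) g) := by
  rw [← integral_inner_eq hf hg]
  exact integral_congr_ae (Eventually.of_forall fun x => by simp [mul_comm])

lemma normSq_eq {f : Pt d → ℝ} (hf : MemLp f 2 (volume.restrict Ω)) :
    normSq Ω f = ‖liftL2 (volume.restrict Ω) f‖ ^ 2 := by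
  rw [← integral_norm_sq_eq hf]
  simp [normSq]

lemma memLp_of_components {v : Pt d → Pt d} {q : ENNReal}
    (h : ∀ j, MemLp (fun x => v x j) q (volume.restrict Ω)) : MemLp v q (volume.restrict Ω) :=
  MemLp.of_eval_piLp h

lemma vip_eq_sum {v w : Pt d → Pt d} (hv : MemLp v 2 (volume.restrict Ω))
    (hw : MemLp w 2 (volume.restrict Ω)) :
    vip Ω v w = ∑ j, ∫ x in Ω, v x j * w x j := by
  rw [← integral_finsetSum _ fun j _ => integrable_mul_of_memLp_two (hv.eval_piLp j)
    (hw.eval_piLp j)]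
  exact integral_congr_ae (Eventually.of_forall fun x => by
    simp [PiLp.inner_apply, mul_comm])

lemma MemH1.memLp_grad {f : Pt d → ℝ} (h : MemH1 Ω f) :
    MemLp (grad Ω f) 2 (volume.restrict Ω) :=
  memLp_of_components fun i => (h.2 i).2

lemma MemH2.memLp_lap {f : Pt d → ℝ} (h : MemH2 Ω f) :
    MemLp (lap Ω f) 2 (volume.restrict Ω) :=
  memLp_finsetSum (f := fun i => weakPartial Ω i (weakPartial Ω i f)) Finset.univ
    fun i _ => ((h.2 i).2 i).2

lemma grad_lincomb (hΩ : IsOpen Ω) {f g : Pt d → ℝ} (hf : MemH1 Ω f) (hg : MemH1 Ω g)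
    (a b : ℝ) : grad Ω (fun x => a * f x + b * g x) =ᵐ[volume.restrict Ω]
      fun x => a • grad Ω f x + b • grad Ω g x := by
  filter_upwards [eventually_all.2 fun i => weakPartial_lincomb hΩ hf hg a b i] with x hx
  ext i
  simp [grad, hx i]

lemma VecMemH2H10.memLp {v : Pt d → Pt d} (h : VecMemH2H10 Ω v) :
    MemLp v 2 (volume.restrict Ω) :=
  memLp_of_components fun j => (h j).2.1.1

/-- Green's formula for `f ∈ H¹₀` and `g ∈ H²`. -/
lemma MemH10.integral_lap_mul {f g : Pt d → ℝ} (hf : MemH10 Ω f) (hg : MemH2 Ω g) :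
    ∫ x in Ω, lap Ω g x * f x = - vip Ω (grad Ω g) (grad Ω f) := by
  rw [vip_eq_sum hg.1.memLp_grad hf.1.memLp_grad, ← Finset.sum_neg_distrib]
  have e : ∀ x, lap Ω g x * f x = ∑ i, f x * weakPartial Ω i (weakPartial Ω i g) x := fun x => by
    rw [mul_comm, ← Finset.mul_sum]
    rfl
  simp only [e]
  rw [integral_finsetSum _ fun i _ =>
    integrable_mul_of_memLp_two hf.1.1 ((hg.2 i).2 i).2]
  refine Finset.sum_congr rfl fun i _ => ?_
  rw [hf.integral_mul_weakPartial (hg.2 i) i]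
  refine congrArg Neg.neg (integral_congr_ae (Eventually.of_forall fun x => ?_))
  simp [grad, mul_comm]

/-- Gradients of `H¹` functions are orthogonal to divergence free `H¹₀` fields. -/
lemma vip_grad_eq_zero {q : Pt d → ℝ} {w : Pt d → Pt d} (hq : MemH1 Ω q)
    (hw : ∀ j, MemH10 Ω (fun x => w x j))
    (hdiv : ∀ᵐ x ∂(volume.restrict Ω), divergence Ω w x = 0) : vip Ω (grad Ω q) w = 0 := by
  rw [vip_eq_sum hq.memLp_grad (memLp_of_components fun j => (hw j).1.1)]
  have e : ∀ j, ∫ x in Ω, grad Ω q x j * w x j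
      = - ∫ x in Ω, weakPartial Ω j (fun y => w y j) x * q x := fun j => by
    rw [← (hw j).integral_mul_weakPartial hq j]
    exact integral_congr_ae (Eventually.of_forall fun x => by simp [grad, mul_comm])
  simp only [e]
  rw [Finset.sum_neg_distrib, ← integral_finsetSum _ fun j _ =>
    integrable_mul_of_memLp_two ((hw j).1.2 j).2 hq.1, neg_eq_zero]
  refine integral_eq_zero_of_ae ?_
  filter_upwards [hdiv] with x hx
  rw [← Finset.sum_mul]
  simp only [divergence] at hx
  rw [hx, zero_mul, Pi.zero_apply]

/-- The flux `φ u` of a velocity field with zero boundary values has zero total divergence. -/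
lemma integral_divergence_smul (hΩ : IsOpen Ω) {φ : Pt d → ℝ} {u : Pt d → Pt d}
    (hφ : MemH1 Ω φ) (hu : ∀ j, MemH10 Ω (fun x => u x j)) :
    Integrable (divergence Ω (fun x => φ x • u x)) (volume.restrict Ω) ∧
      ∫ x in Ω, divergence Ω (fun x => φ x • u x) x = 0 := by
  have h1 : ∀ j, weakPartial Ω j (fun x => φ x * u x j) =ᵐ[volume.restrict Ω]
      fun x => φ x * weakPartial Ω j (fun y => u y j) x + weakPartial Ω j φ x * u x j :=
    fun j => ((hu j).hasWeakPartial_mul hφ j).weakPartial_ae_eq hΩ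
  have i1 : ∀ j, Integrable (fun x => φ x * weakPartial Ω j (fun y => u y j) x)
      (volume.restrict Ω) := fun j => integrable_mul_of_memLp_two hφ.1 ((hu j).1.2 j).2
  have i2 : ∀ j, Integrable (fun x => weakPartial Ω j φ x * u x j)
      (volume.restrict Ω) := fun j => integrable_mul_of_memLp_two (hφ.2 j).2 (hu j).1.1
  have i3 : ∀ j, Integrable (weakPartial Ω j (fun x => φ x * u x j)) (volume.restrict Ω) :=
    fun j => ((i1 j).add (i2 j)).congr (h1 j).symm
  have e : divergence Ω (fun x => φ x • u x)
      = fun x => ∑ j, weakPartial Ω j (fun x => φ x * u x j) x := by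
    funext x
    simp [divergence]
  rw [e]
  refine ⟨integrable_finsetSum _ fun j _ => i3 j, ?_⟩
  rw [integral_finsetSum _ fun j _ => i3 j]
  refine Finset.sum_eq_zero fun j _ => ?_
  rw [integral_congr_ae (h1 j), integral_add (i1 j) (i2 j)]
  have h := (hu j).integral_mul_weakPartial hφ j
  simp only [mul_comm] at h ⊢
  linarith

/-- The convective form is integrable on `H¹₀`. -/
lemma integrable_convect (hd : d = 2 ∨ d = 3) (hb : Bornology.IsBounded Ω) {u w : Pt d → Pt d}
    (hu : ∀ j, MemH10 Ω (fun x => u x j)) (hw : ∀ j, MemH10 Ω (fun x => w x j)) :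
    Integrable (fun x => inner ℝ (convect Ω u u x) (w x)) (volume.restrict Ω) := by
  have e : (fun x => inner ℝ (convect Ω u u x) (w x)) = fun x => ∑ j, ∑ i,
      weakPartial Ω i (fun y => u y j) x * (u x i * w x j) := by
    funext x
    simp only [PiLp.inner_apply, convect, RCLike.inner_apply, conj_trivial, Finset.mul_sum]
    exact Finset.sum_congr rfl fun j _ => Finset.sum_congr rfl fun i _ => by ring
  rw [e]
  refine integrable_finsetSum _ fun j _ => integrable_finsetSum _ fun i _ => ?_
  have : ENNReal.HolderTriple 4 4 2 := ⟨by
    rw [← two_mul, show (4 : ENNReal) = 2 * 2 by norm_num, ENNReal.mul_inv (by simp) (by simp),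
      ← mul_assoc, ENNReal.mul_inv_cancel (by simp) (by simp), one_mul]⟩
  -- Two `L⁴` factors give an `L²` product, which pairs with the `L²` derivative of `u`.
  have hm : MemLp (fun x => u x i * w x j) 2 (volume.restrict Ω) :=
    MemLp.mul' (p := 4) (q := 4) (r := 2) ((hw j).memLp_four hd hb) ((hu i).memLp_four hd hb)
  exact integrable_mul_of_memLp_two ((hu j).1.2 i).2 hm

/-! ### Geometry -/

lemma IsConvexPolytopalDomain.isOpen (h : IsConvexPolytopalDomain Ω) : IsOpen Ω := by
  obtain ⟨-, s, rfl⟩ := h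
  exact isOpen_interior

lemma IsConvexPolytopalDomain.isBounded (h : IsConvexPolytopalDomain Ω) :
    Bornology.IsBounded Ω := by
  obtain ⟨-, s, rfl⟩ := h
  exact (isBounded_convexHull.2 s.finite_toSet.isBounded).subset interior_subset

/-! ### Tests of the scheme -/

lemma ZeroNormalDeriv.integral_lap_mul {f v : Pt d → ℝ} (h : ZeroNormalDeriv Ω f)
    (hf : MemH2 Ω f) (hv : MemH1 Ω v) :
    ∫ x in Ω, lap Ω f x * v x = - vip Ω (grad Ω f) (grad Ω v) := by
  have e := h v hv
  rw [integral_add (integrable_mul_of_memLp_two hf.memLp_lap hv.1)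
    (integrable_inner_of_memLp hf.1.memLp_grad hv.memLp_grad)] at e
  rw [vip]
  linarith

/-- The Neumann condition tested with the constant `1`, which lies in `H¹` because `Ω` has finite
measure. -/
lemma ZeroNormalDeriv.integral_lap (hΩ : IsOpen Ω) (hfin : volume Ω ≠ ⊤) {f : Pt d → ℝ}
    (h : ZeroNormalDeriv Ω f) (hf : MemH2 Ω f) : ∫ x in Ω, lap Ω f x = 0 := by
  have e := h.integral_lap_mul hf (memH1_const hΩ hfin 1)
  have h0 : vip Ω (grad Ω f) (grad Ω fun _ => (1 : ℝ)) = 0 := by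
    refine integral_eq_zero_of_ae ?_
    filter_upwards [eventually_all.2 fun i => weakPartial_const hΩ hfin i 1] with x hx
    simp [PiLp.inner_apply, grad, hx]
  simpa [h0] using e

/-- The discrete time derivative of the phase field has mean zero. -/
lemma integral_time_derivative_eq_zero (hΩ : IsOpen Ω) (hfin : volume Ω ≠ ⊤)
    {φ dphi m : Pt d → ℝ} {u : Pt d → Pt d} {ξ M : ℝ} (hφ : MemH1 Ω φ)
    (hu : ∀ j, MemH10 Ω (fun x => u x j)) (hm : MemH2 Ω m) (hbc : ZeroNormalDeriv Ω m)
    (h : ∀ᵐ x ∂(volume.restrict Ω),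
      dphi x + ξ * divergence Ω (fun y => φ y • u y) x = M * lap Ω m x) :
    ∫ x in Ω, dphi x = 0 := by
  have : IsFiniteMeasure (volume.restrict Ω) := isFiniteMeasure_restrict.2 hfin
  obtain ⟨hi, h0⟩ := integral_divergence_smul hΩ hφ hu
  have e : dphi =ᵐ[volume.restrict Ω]
      fun x => M * lap Ω m x - ξ * divergence Ω (fun y => φ y • u y) x := by
    filter_upwards [h] with x hx
    linarith
  rw [integral_congr_ae e, integral_sub ((hm.memLp_lap.integrable one_le_two).const_mul M)
    (hi.const_mul ξ), integral_const_mul, integral_const_mul, h0, hbc.integral_lap hΩ hfin hm]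
  simp

/-- The phase field equation tested with the chemical potential. -/
lemma phi_balance {ψ δ m : Pt d → ℝ} {ξ M : ℝ} (hδ : MemLp δ 2 (volume.restrict Ω))
    (hm : MemH2 Ω m) (hbc : ZeroNormalDeriv Ω m)
    (h : ∀ᵐ x ∂(volume.restrict Ω), δ x + ξ * ψ x = M * lap Ω m x) :
    ξ * ip Ω m ψ + ip Ω m δ = - M * gradNormSq Ω m := by
  -- Moving `ξ` under the integral and substituting the equation there avoids any integrability
  -- requirement on `m * ψ`.
  have e : ξ * ip Ω m ψ = ∫ x in Ω, (M * (lap Ω m x * m x) - m x * δ x) := by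
    rw [ip, ← integral_const_mul]
    refine integral_congr_ae ?_
    filter_upwards [h] with x hx
    linear_combination m x * hx
  have hg : gradNormSq Ω m = vip Ω (grad Ω m) (grad Ω m) := by
    simp [gradNormSq, vnormSq, vip]
  rw [e, integral_sub ((integrable_mul_of_memLp_two hm.memLp_lap hm.1.1).const_mul M)
    (integrable_mul_of_memLp_two hm.1.1 hδ), integral_const_mul,
    hbc.integral_lap_mul hm hm.1, hg, ip]
  ring

/-- The chemical potential equation tested with the discrete time derivative. -/
lemma mu_balance {m φ ψ δ : Pt d → ℝ} {lam β ξ : ℝ} (hδ : MemH1 Ω δ)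
    (hm : MemLp m 2 (volume.restrict Ω)) (hφ : MemH2 Ω φ) (hbc : ZeroNormalDeriv Ω φ)
    (h : ∀ᵐ x ∂(volume.restrict Ω),
      m x = - lam * lap Ω φ x + lam * β * φ x + lam * ξ * ψ x) :
    lam * ξ * ip Ω ψ δ
      = ip Ω m δ - lam * vip Ω (grad Ω φ) (grad Ω δ) - lam * β * ip Ω φ δ := by
  -- Again the equation is substituted under one integral, so nothing has to be known about the
  -- integrability of the nonlinear term `ψ`.
  have e : lam * ξ * ip Ω ψ δ
      = ∫ x in Ω, ((m x * δ x + lam * (lap Ω φ x * δ x)) - lam * β * (φ x * δ x)) := by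
    rw [ip, ← integral_const_mul]
    refine integral_congr_ae ?_
    filter_upwards [h] with x hx
    linear_combination - δ x * hx
  have i1 := integrable_mul_of_memLp_two hm hδ.1
  have i2 := (integrable_mul_of_memLp_two hφ.memLp_lap hδ.1).const_mul lam
  have i3 := (integrable_mul_of_memLp_two hφ.1.1 hδ.1).const_mul (lam * β)
  rw [e, integral_sub (i1.fun_add i2) i3, integral_add i1 i2, integral_const_mul, integral_const_mul,
    hbc.integral_lap_mul hφ hδ, ip, ip]
  ring

lemma VecMemH2H10.memLp_vecLap {v : Pt d → Pt d} (h : VecMemH2H10 Ω v) :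
    MemLp (vecLap Ω v) 2 (volume.restrict Ω) :=
  memLp_of_components fun j => (h j).1.memLp_lap

lemma vip_vecLap {v w : Pt d → Pt d} (hv : VecMemH2H10 Ω v)
    (hw : ∀ j, MemH10 Ω (fun x => w x j)) :
    vip Ω (vecLap Ω v) w
      = - ∑ j, vip Ω (grad Ω (fun x => v x j)) (grad Ω (fun x => w x j)) := by
  rw [vip_eq_sum hv.memLp_vecLap (memLp_of_components fun j => (hw j).1.1),
    ← Finset.sum_neg_distrib]
  exact Finset.sum_congr rfl fun j _ => (hw j).integral_lap_mul (hv j).1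

/-- The momentum equation tested with the intermediate velocity. -/
lemma momentum_balance (hd : d = 2 ∨ d = 3) (hb : Bornology.IsBounded Ω)
    {φ p : Pt d → ℝ} {g u du w : Pt d → Pt d} {ξ γ ν : ℝ}
    (hp : MemH1 Ω p) (hu : ∀ j, MemH10 Ω (fun x => u x j))
    (hdu : MemLp du 2 (volume.restrict Ω)) (hw : VecMemH2H10 Ω w)
    (h : ∀ᵐ x ∂(volume.restrict Ω),
      du x + ξ • convect Ω u u x - ν • vecLap Ω w x
        = - ξ • (φ x • g x + γ • grad Ω p x)) :
    ξ * (vip Ω w (fun x => φ x • g x) + trilinear Ω u u w + γ * vip Ω (grad Ω p) w)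
      = - vip Ω du w - ν * vgradNormSq Ω w := by
  have i2 := integrable_convect hd hb hu fun j => (hw j).2
  have i3 := (integrable_inner_of_memLp hp.memLp_grad hw.memLp).const_mul γ
  have i4 := integrable_inner_of_memLp hdu hw.memLp
  have i5 := (integrable_inner_of_memLp hw.memLp_vecLap hw.memLp).const_mul ν
  have e : ∀ᵐ x ∂(volume.restrict Ω),
      ξ * (inner ℝ (w x) (φ x • g x) + inner ℝ (convect Ω u u x) (w x)
          + γ * inner ℝ (grad Ω p x) (w x))
        = ν * inner ℝ (vecLap Ω w x) (w x) - inner ℝ (du x) (w x) := by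
    filter_upwards [h] with x hx
    have := congrArg (fun z => inner ℝ z (w x)) hx
    simp only [inner_add_left, inner_sub_left, inner_smul_left, neg_smul, inner_neg_left,
      conj_trivial] at this
    rw [inner_smul_right, real_inner_comm]
    linarith
  have hg : vgradNormSq Ω w = - vip Ω (vecLap Ω w) w := by
    rw [vip_vecLap hw fun j => (hw j).2, neg_neg]
    simp [vgradNormSq, gradNormSq, vnormSq, vip]
  have r : ∫ x in Ω, (ν * inner ℝ (vecLap Ω w x) (w x) - inner ℝ (du x) (w x))
      = - vip Ω du w - ν * vgradNormSq Ω w := by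
    rw [integral_sub i5 i4, integral_const_mul, hg, vip, vip]
    ring
  rw [← r, ← integral_congr_ae e, integral_const_mul]
  -- Nothing is assumed on `φ` and `g`, so the integrability of the coupling term is not available
  -- directly. For `ξ ≠ 0` the equation expresses this term through integrable ones; for `ξ = 0`
  -- both sides vanish.
  rcases eq_or_ne ξ 0 with rfl | hξ
  · simp
  congr 1
  have i1 : Integrable (fun x => inner ℝ (w x) (φ x • g x)) (volume.restrict Ω) := by
    refine ((((i5.sub i4).const_mul ξ⁻¹).sub i2).sub i3).congr ?_
    filter_upwards [e] with x hx
    simp only [Pi.sub_apply]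
    rw [← hx, inv_mul_cancel_left₀ hξ]
    ring
  rw [integral_add (i1.fun_add i2) i3, integral_add i1 i2, integral_const_mul]
  rfl

/-- The energy balance common to the first- and second-order schemes. -/
lemma energy_balance (hd : d = 2 ∨ d = 3) (hb : Bornology.IsBounded Ω) (P : Params)
    {new : State d} (hnew : new.Admissible Ω) {φ μ p dphi : Pt d → ℝ} {u du : Pt d → Pt d}
    {dR ξ γ : ℝ} (hp : MemH1 Ω p) (hu : ∀ j, MemH10 Ω (fun x => u x j)) (hdphi : MemH1 Ω dphi)
    (hdu : MemLp du 2 (volume.restrict Ω)) (hξ : ξ = new.R / sqrtE1 Ω P φ)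
    (phi_eq : ∀ᵐ x ∂(volume.restrict Ω),
      dphi x + ξ * divergence Ω (fun y => φ y • u y) x = P.M * lap Ω new.mu x)
    (mu_eq : ∀ᵐ x ∂(volume.restrict Ω),
      new.mu x = - P.lam * lap Ω new.phi x + P.lam * P.beta * new.phi x
        + P.lam * ξ * P.F' (φ x))
    (uhat_eq : ∀ᵐ x ∂(volume.restrict Ω),
      du x + ξ • convect Ω u u x - P.nu • vecLap Ω new.uhat x
        = - ξ • (φ x • grad Ω μ x + γ • grad Ω p x))
    (R_eq : SAVEquation Ω P dR dphi φ μ u p γ new) :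
    P.lam * vip Ω (grad Ω new.phi) (grad Ω dphi) + P.lam * P.beta * ip Ω new.phi dphi
      + 2 * P.lam * (new.R * dR) + vip Ω du new.uhat + P.nu * vgradNormSq Ω new.uhat
      + P.M * gradNormSq Ω new.mu = 0 := by
  have e1 := phi_balance hdphi.1 hnew.mu_mem hnew.mu_bc phi_eq
  have e2 := mu_balance hdphi hnew.mu_mem.1.1 hnew.phi_mem hnew.phi_bc mu_eq
  have e3 := momentum_balance hd hb hp hu hdu hnew.uhat_mem uhat_eq
  have hl : P.lam ≠ 0 := P.lam_pos.ne'
  -- Only `lam` is cancelled; the inverse of the square root stays as a factor, so its sign and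
  -- vanishing play no role here.
  have hc : 2 * P.lam * (new.R * (1 / (2 * P.lam * sqrtE1 Ω P φ))) = ξ := by
    rw [hξ, one_div, mul_inv, div_eq_mul_inv]
    field_simp
  have e4 : 2 * P.lam * (new.R * dR) = ξ * (P.lam * ip Ω (fun x => P.F' (φ x)) dphi
      + ip Ω new.mu (divergence Ω (fun x => φ x • u x)))
      + ξ * (vip Ω new.uhat (fun x => φ x • grad Ω μ x) + trilinear Ω u u new.uhat
      + γ * vip Ω (grad Ω p) new.uhat) := by
    rw [R_eq, ← hc]
    ring
  linarith

/-- The velocity correction tested with divergence free fields. -/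
lemma projection_balance (hΩ : IsOpen Ω) {v v' w : Pt d → Pt d} {q p : Pt d → ℝ} {κ ν γ : ℝ}
    (hv : VecMemH2H10 Ω v) (hv' : VecMemH2H10 Ω v') (hq : MemH1 Ω q) (hp : MemH1 Ω p)
    (hw : ∀ j, MemH10 Ω (fun x => w x j))
    (hdiv : ∀ᵐ x ∂(volume.restrict Ω), divergence Ω w x = 0)
    (h : ∀ᵐ x ∂(volume.restrict Ω),
      κ • (v x - v' x) - ν • vecLap Ω (fun y => v y - v' y) x + grad Ω q x
        = γ • grad Ω p x) :
    κ * vip Ω (fun x => v x - v' x) w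
      + ν * ∑ j, vip Ω (grad Ω (fun x => v x j - v' x j)) (grad Ω (fun x => w x j)) = 0 := by
  have hz : VecMemH2H10 Ω (fun x => v x - v' x) := fun j => by
    have e : (fun x => (v x - v' x) j) = fun x => 1 * v x j + (-1) * v' x j := by
      funext x
      simp [sub_eq_add_neg]
    rw [e]
    exact ⟨(hv j).1.lincomb hΩ (hv' j).1 1 (-1), (hv j).2.lincomb hΩ (hv' j).2 1 (-1)⟩
  have hwm : MemLp w 2 (volume.restrict Ω) := memLp_of_components fun j => (hw j).1.1
  have i1 := (integrable_inner_of_memLp hz.memLp hwm).const_mul κ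
  have i2 := (integrable_inner_of_memLp hz.memLp_vecLap hwm).const_mul ν
  have i3 := integrable_inner_of_memLp hq.memLp_grad hwm
  have e : ∫ x in Ω, ((κ * inner ℝ (v x - v' x) (w x)
      - ν * inner ℝ (vecLap Ω (fun y => v y - v' y) x) (w x)) + inner ℝ (grad Ω q x) (w x))
      = ∫ x in Ω, γ * inner ℝ (grad Ω p x) (w x) := by
    refine integral_congr_ae ?_
    filter_upwards [h] with x hx
    have := congrArg (fun z => inner ℝ z (w x)) hx
    simpa only [inner_add_left, inner_sub_left, inner_smul_left, conj_trivial] using this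
  rw [integral_add (show Integrable (fun x => κ * inner ℝ (v x - v' x) (w x)
    - ν * inner ℝ (vecLap Ω (fun y => v y - v' y) x) (w x)) (volume.restrict Ω) from i1.sub i2) i3, integral_sub i1 i2, integral_const_mul, integral_const_mul,
    integral_const_mul] at e
  -- Both pressure gradients are orthogonal to `w`, so `γ` disappears from the result.
  have z1 := vip_grad_eq_zero hq hw hdiv
  have z2 := vip_grad_eq_zero hp hw hdiv
  have z3 := vip_vecLap hz hw
  simp only [vip, PiLp.sub_apply] at z1 z2 z3 e ⊢
  rw [z1, z2, z3] at e
  linarith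

/-! ### Discrete inequalities in inner product spaces -/

section Abstract

variable {H K : Type*} [NormedAddCommGroup H] [InnerProductSpace ℝ H]
  [NormedAddCommGroup K] [InnerProductSpace ℝ K]

/-- The right side minus the left side is exactly `¼ ‖a - 2b + c‖²`. -/
lemma bdf2_inequality {τ : ℝ} (hτ : 0 < τ) (a b c : H) :
    1 / 4 * (‖a‖ ^ 2 + ‖extrap b a‖ ^ 2) - 1 / 4 * (‖b‖ ^ 2 + ‖extrap c b‖ ^ 2)
      ≤ τ * inner ℝ a (bdf2 τ c b a) := by
  have h := sq_nonneg ‖a - (2 : ℝ) • b + c‖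
  have hc : τ * inner ℝ a (bdf2 τ c b a)
      = 1 / 2 * inner ℝ a ((3 : ℝ) • a - (4 : ℝ) • b + c) := by
    rw [bdf2, inner_smul_right]
    field_simp
  rw [hc]
  simp only [extrap, ← real_inner_self_eq_norm_sq, inner_add_left, inner_add_right, inner_sub_left,
    inner_sub_right, real_inner_smul_left, real_inner_smul_right] at h ⊢
  simp only [real_inner_comm a b, real_inner_comm a c, real_inner_comm b c] at *
  linarith

/-- This is the case `c = b` of the BDF2 estimate, whence the factor `3/2`; the defect is `¼ ‖a -
b‖²`. -/
lemma euler_inequality {τ : ℝ} (hτ : 0 < τ) (a b : H) :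
    1 / 4 * (‖a‖ ^ 2 + ‖extrap b a‖ ^ 2) - 1 / 4 * (‖b‖ ^ 2 + ‖extrap b b‖ ^ 2)
      ≤ 3 / 2 * (τ * inner ℝ a ((1 / τ) • (a - b))) := by
  have h := sq_nonneg ‖a - b‖
  have hc : τ * inner ℝ a ((1 / τ) • (a - b)) = inner ℝ a (a - b) := by
    rw [inner_smul_right]
    field_simp
  rw [hc]
  simp only [extrap, ← real_inner_self_eq_norm_sq, inner_sub_left,
    inner_sub_right, real_inner_smul_left, real_inner_smul_right] at h ⊢
  simp only [real_inner_comm a b] at *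
  linarith

/-- Stability of the velocity update of the second-order scheme: `h` is the intermediate velocity
and capital letters stand for gradients. -/
lemma bdf2_velocity_inequality {τ ν : ℝ} (hτ : 0 < τ) (hν : 0 < ν) {a b c h : H} {A B D : K}
    (ha : 3 / (2 * τ) * inner ℝ (a - h) a + ν * inner ℝ (A - D) A = 0)
    (hb : 3 / (2 * τ) * inner ℝ (a - h) b + ν * inner ℝ (A - D) B = 0) :
    1 / 4 * (‖a‖ ^ 2 + ‖extrap b a‖ ^ 2) - 1 / 4 * (‖b‖ ^ 2 + ‖extrap c b‖ ^ 2)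
        + ν * τ / 6 * (‖A‖ ^ 2 - ‖B‖ ^ 2) + ν * τ / 6 * (‖A - D‖ ^ 2 + ‖D‖ ^ 2)
      ≤ τ * (inner ℝ (bdf2 τ c b h) h + ν * ‖D‖ ^ 2) := by
  have hk : 0 < ν * τ := mul_pos hν hτ
  -- Once `ha'` and `hb'` eliminate the pairings of `h - a` with `a` and `b`, the defect is exactly
  -- `¼` of the first square, `5/4` of the second, and `ντ` times `1/6 ‖B - 2(A - D)‖² + 2/3 ‖A‖²`.
  -- The mixed term in `A` and `A - D` cancels upon expanding `D = A - (A - D)`.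
  have h1 := sq_nonneg ‖a - (2 : ℝ) • b + c + (h - a)‖
  have h2 := sq_nonneg ‖h - a‖
  have h3 := mul_nonneg hk.le (sq_nonneg ‖B - (2 : ℝ) • (A - D)‖)
  have h4 := mul_nonneg hk.le (sq_nonneg ‖A‖)
  have ha' : 3 / 2 * inner ℝ (a - h) a + ν * τ * inner ℝ (A - D) A = 0 := by
    field_simp at ha ⊢
    linarith
  have hb' : 3 / 2 * inner ℝ (a - h) b + ν * τ * inner ℝ (A - D) B = 0 := by
    field_simp at hb ⊢
    linarith
  have hc : τ * (inner ℝ (bdf2 τ c b h) h + ν * ‖D‖ ^ 2)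
      = 1 / 2 * inner ℝ ((3 : ℝ) • h - (4 : ℝ) • b + c) h + ν * τ * ‖D‖ ^ 2 := by
    rw [bdf2, inner_smul_left, conj_trivial]
    field_simp
  rw [hc]
  simp only [extrap, ← real_inner_self_eq_norm_sq, inner_add_left, inner_add_right, inner_sub_left,
    inner_sub_right, real_inner_smul_left, real_inner_smul_right] at h1 h2 h3 h4 ha' hb' ⊢
  simp only [real_inner_comm a b, real_inner_comm a c, real_inner_comm b c, real_inner_comm a h,
    real_inner_comm b h, real_inner_comm c h, real_inner_comm A B, real_inner_comm A D,
    real_inner_comm B D] at *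
  linarith

/-- Stability of the velocity update of the first-order scheme. -/
lemma euler_velocity_inequality {τ ν : ℝ} (hτ : 0 < τ) (hν : 0 < ν) {a b h : H} {A B D : K}
    (ha : 1 / τ * inner ℝ (a - h) a + ν * inner ℝ (A - D) A = 0)
    (hb : 1 / τ * inner ℝ (a - h) b + ν * inner ℝ (A - D) B = 0) :
    1 / 4 * (‖a‖ ^ 2 + ‖extrap b a‖ ^ 2) - 1 / 4 * (‖b‖ ^ 2 + ‖extrap b b‖ ^ 2)
        + ν * τ / 6 * (‖A‖ ^ 2 - ‖B‖ ^ 2) + ν * τ / 6 * (‖A - D‖ ^ 2 + ‖D‖ ^ 2)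
      ≤ 3 / 2 * (τ * (inner ℝ ((1 / τ) • (h - b)) h + ν * ‖D‖ ^ 2)) := by
  have hk : 0 < ν * τ := mul_pos hν hτ
  -- The pairing `-3/4 ⟨A - D, B⟩` left by this square, together with `1/6 ‖B‖²`, dictates the
  -- constant `9/4` in `h3`. Writing `⟨A - D, A⟩` by polarization then leaves `23/24 ‖A‖² + 5/24
  -- ‖D‖² + 11/96 ‖A - D‖²`, times `ντ`.
  have h1 := sq_nonneg ‖a - b + (3 / 2 : ℝ) • (h - a)‖
  have h2 := sq_nonneg ‖h - a‖
  have h3 := mul_nonneg hk.le (sq_nonneg ‖B - (9 / 4 : ℝ) • (A - D)‖)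
  have h4 := mul_nonneg hk.le (sq_nonneg ‖A‖)
  have h5 := mul_nonneg hk.le (sq_nonneg ‖D‖)
  have h6 := mul_nonneg hk.le (sq_nonneg ‖A - D‖)
  have ha' : inner ℝ (a - h) a + ν * τ * inner ℝ (A - D) A = 0 := by
    field_simp at ha ⊢
    linarith
  have hb' : inner ℝ (a - h) b + ν * τ * inner ℝ (A - D) B = 0 := by
    field_simp at hb ⊢
    linarith
  have hc : τ * (inner ℝ ((1 / τ) • (h - b)) h + ν * ‖D‖ ^ 2)
      = inner ℝ (h - b) h + ν * τ * ‖D‖ ^ 2 := by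
    rw [inner_smul_left, conj_trivial]
    field_simp
  rw [hc]
  simp only [extrap, ← real_inner_self_eq_norm_sq, inner_add_left, inner_add_right, inner_sub_left,
    inner_sub_right, real_inner_smul_left, real_inner_smul_right]
    at h1 h2 h3 h4 h5 h6 ha' hb' ⊢
  simp only [real_inner_comm a b, real_inner_comm a h,
    real_inner_comm b h, real_inner_comm A B, real_inner_comm A D,
    real_inner_comm B D] at *
  linarith

end Abstract

/-! ### Linear combinations of time levels -/

section Levels

variable {α E : Type*} [MeasurableSpace α] [NormedAddCommGroup E] {μ : Measure α}

lemma liftL2_sub {f g : α → E} (hf : MemLp f 2 μ) (hg : MemLp g 2 μ) :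
    liftL2 μ (fun x => f x - g x) = liftL2 μ f - liftL2 μ g := by
  rw [liftL2_of_memLp (f := fun x => f x - g x) (hf.sub hg), liftL2_of_memLp hf,
    liftL2_of_memLp hg]
  rfl

variable [InnerProductSpace ℝ E]

lemma memLp_extrap {f g : α → E} (hf : MemLp f 2 μ) (hg : MemLp g 2 μ) :
    MemLp (extrap f g) 2 μ := (hg.const_smul 2).sub hf

lemma memLp_bdf2 {τ : ℝ} {f g h : α → E} (hf : MemLp f 2 μ) (hg : MemLp g 2 μ)
    (hh : MemLp h 2 μ) : MemLp (bdf2 τ f g h) 2 μ :=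
  ((((hh.const_smul 3).sub (hg.const_smul 4)).add hf).const_smul _)

lemma liftL2_extrap {f g : α → E} (hf : MemLp f 2 μ) (hg : MemLp g 2 μ) :
    liftL2 μ (extrap f g) = extrap (liftL2 μ f) (liftL2 μ g) := by
  rw [liftL2_of_memLp (memLp_extrap hf hg), liftL2_of_memLp hf, liftL2_of_memLp hg]
  rfl

lemma liftL2_bdf2 {τ : ℝ} {f g h : α → E} (hf : MemLp f 2 μ) (hg : MemLp g 2 μ)
    (hh : MemLp h 2 μ) :
    liftL2 μ (bdf2 τ f g h) = bdf2 τ (liftL2 μ f) (liftL2 μ g) (liftL2 μ h) := by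
  rw [liftL2_of_memLp (memLp_bdf2 hf hg hh), liftL2_of_memLp hf, liftL2_of_memLp hg,
    liftL2_of_memLp hh]
  rfl

end Levels

lemma extrap_eq (f g : Pt d → ℝ) : extrap f g = fun x => 2 * g x + (-1) * f x := by
  funext x
  simp [extrap, sub_eq_add_neg]

lemma bdf2_eq (τ : ℝ) (f g h : Pt d → ℝ) :
    bdf2 τ f g h = fun x => 3 / (2 * τ) * h x
      + 1 * (-4 / (2 * τ) * g x + 1 / (2 * τ) * f x) := by
  funext x
  simp only [bdf2, Pi.add_apply, Pi.sub_apply, Pi.smul_apply, smul_eq_mul]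
  ring

lemma sub_eq (f g : Pt d → ℝ) : (fun x => f x - g x) = fun x => 1 * f x + (-1) * g x := by
  funext x
  ring

lemma difference_quotient_eq (τ : ℝ) (f g : Pt d → ℝ) :
    (fun x => (f x - g x) / τ) = fun x => 1 / τ * f x + (-1 / τ) * g x := by
  funext x
  ring

lemma MemH1.extrap (hΩ : IsOpen Ω) {f g : Pt d → ℝ} (hf : MemH1 Ω f) (hg : MemH1 Ω g) :
    MemH1 Ω (extrap f g) := by
  rw [extrap_eq]
  exact hg.lincomb hΩ hf _ _

lemma MemH10.extrap (hΩ : IsOpen Ω) {v w : Pt d → Pt d} (hv : ∀ j, MemH10 Ω (fun x => v x j))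
    (hw : ∀ j, MemH10 Ω (fun x => w x j)) (j : Fin d) :
    MemH10 Ω (fun x => CHNS.extrap v w x j) := by
  have e : (fun x => CHNS.extrap v w x j) = fun x => 2 * w x j + (-1) * v x j := by
    funext x
    simp [CHNS.extrap, sub_eq_add_neg]
  rw [e]
  exact (hw j).lincomb hΩ (hv j) _ _

lemma MemH1.bdf2 (hΩ : IsOpen Ω) (τ : ℝ) {f g h : Pt d → ℝ} (hf : MemH1 Ω f) (hg : MemH1 Ω g)
    (hh : MemH1 Ω h) : MemH1 Ω (bdf2 τ f g h) := by
  rw [bdf2_eq]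
  exact hh.lincomb hΩ (hg.lincomb hΩ hf _ _) _ _

lemma liftL2_grad_extrap (hΩ : IsOpen Ω) {f g : Pt d → ℝ} (hf : MemH1 Ω f) (hg : MemH1 Ω g) :
    liftL2 (volume.restrict Ω) (grad Ω (extrap f g))
      = extrap (liftL2 (volume.restrict Ω) (grad Ω f)) (liftL2 (volume.restrict Ω) (grad Ω g)) := by
  rw [extrap_eq, liftL2_lincomb hg.memLp_grad hf.memLp_grad (grad_lincomb hΩ hg hf _ _), extrap]
  module

lemma liftL2_grad_bdf2 (hΩ : IsOpen Ω) (τ : ℝ) {f g h : Pt d → ℝ} (hf : MemH1 Ω f)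
    (hg : MemH1 Ω g) (hh : MemH1 Ω h) :
    liftL2 (volume.restrict Ω) (grad Ω (bdf2 τ f g h))
      = bdf2 τ (liftL2 (volume.restrict Ω) (grad Ω f)) (liftL2 (volume.restrict Ω) (grad Ω g))
        (liftL2 (volume.restrict Ω) (grad Ω h)) := by
  have h1 := hg.lincomb hΩ hf (-4 / (2 * τ)) (1 / (2 * τ))
  rw [bdf2_eq, liftL2_lincomb hh.memLp_grad h1.memLp_grad (grad_lincomb hΩ hh h1 _ _),
    liftL2_lincomb hg.memLp_grad hf.memLp_grad (grad_lincomb hΩ hg hf _ _), bdf2]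
  module

lemma liftL2_grad_sub (hΩ : IsOpen Ω) {f g : Pt d → ℝ} (hf : MemH1 Ω f) (hg : MemH1 Ω g) :
    liftL2 (volume.restrict Ω) (grad Ω (fun x => f x - g x))
      = liftL2 (volume.restrict Ω) (grad Ω f) - liftL2 (volume.restrict Ω) (grad Ω g) := by
  rw [sub_eq, liftL2_lincomb hf.memLp_grad hg.memLp_grad (grad_lincomb hΩ hf hg _ _)]
  module

lemma liftL2_grad_difference_quotient (hΩ : IsOpen Ω) (τ : ℝ) {f g : Pt d → ℝ}
    (hf : MemH1 Ω f) (hg : MemH1 Ω g) :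
    liftL2 (volume.restrict Ω) (grad Ω (fun x => (f x - g x) / τ)) = (1 / τ) •
      (liftL2 (volume.restrict Ω) (grad Ω f) - liftL2 (volume.restrict Ω) (grad Ω g)) := by
  rw [difference_quotient_eq,
    liftL2_lincomb hf.memLp_grad hg.memLp_grad (grad_lincomb hΩ hf hg _ _)]
  module

lemma liftL2_difference_quotient (τ : ℝ) {f g : Pt d → ℝ}
    (hf : MemLp f 2 (volume.restrict Ω)) (hg : MemLp g 2 (volume.restrict Ω)) :
    liftL2 (volume.restrict Ω) (fun x => (f x - g x) / τ) = (1 / τ) •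
      (liftL2 (volume.restrict Ω) f - liftL2 (volume.restrict Ω) g) := by
  rw [difference_quotient_eq, liftL2_lincomb (k := fun x => 1 / τ * f x + -1 / τ * g x) hf hg (a := 1 / τ) (b := -1 / τ)
    (Eventually.of_forall fun x => rfl)]
  module

/-- The Jacobian of a vector field, as an element of a Hilbert space. -/
def liftGrad (Ω : Set (Pt d)) (v : Pt d → Pt d) :
    PiLp 2 (fun _ : Fin d => Lp (Pt d) 2 (volume.restrict Ω)) :=
  WithLp.toLp 2 fun j => liftL2 (volume.restrict Ω) (grad Ω fun x => v x j)

lemma sum_vip_grad_eq {v w : Pt d → Pt d} (hv : ∀ j, MemH1 Ω (fun x => v x j))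
    (hw : ∀ j, MemH1 Ω (fun x => w x j)) :
    ∑ j, vip Ω (grad Ω (fun x => v x j)) (grad Ω (fun x => w x j))
      = inner ℝ (liftGrad Ω v) (liftGrad Ω w) := by
  rw [PiLp.inner_apply]
  exact Finset.sum_congr rfl fun j _ => integral_inner_eq (hv j).memLp_grad (hw j).memLp_grad

lemma gradNormSq_eq {f : Pt d → ℝ} (hf : MemH1 Ω f) :
    gradNormSq Ω f = ‖liftL2 (volume.restrict Ω) (grad Ω f)‖ ^ 2 :=
  integral_norm_sq_eq hf.memLp_grad

lemma vgradNormSq_eq {v : Pt d → Pt d} (hv : ∀ j, MemH1 Ω (fun x => v x j)) :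
    vgradNormSq Ω v = ‖liftGrad Ω v‖ ^ 2 := by
  rw [PiLp.norm_sq_eq_of_L2]
  exact Finset.sum_congr rfl fun j _ => gradNormSq_eq (hv j)

lemma liftGrad_sub (hΩ : IsOpen Ω) {v w : Pt d → Pt d} (hv : ∀ j, MemH1 Ω (fun x => v x j))
    (hw : ∀ j, MemH1 Ω (fun x => w x j)) :
    liftGrad Ω (fun x => v x - w x) = liftGrad Ω v - liftGrad Ω w := by
  ext1 j
  exact liftL2_grad_sub hΩ (hv j) (hw j)

lemma VecMemH2H10.memH1 {v : Pt d → Pt d} (h : VecMemH2H10 Ω v) (j : Fin d) :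
    MemH1 Ω (fun x => v x j) := (h j).1.1

/-! ### Energy dissipation and mass conservation of the two schemes -/

/-- The regularity shared by the initial level and all later levels. -/
structure State.Regular (Ω : Set (Pt d)) (s : State d) : Prop where
  phi_mem : MemH1 Ω s.phi
  u_mem : VecMemH2H10 Ω s.u
  u_div : ∀ᵐ x ∂(volume.restrict Ω), divergence Ω s.u x = 0
  p_mem : MemH1 Ω s.p

lemma InitialLevel.regular {P : Params} {s : State d} (h : InitialLevel Ω P s) : s.Regular Ω :=
  ⟨h.phi_mem.1, h.u_mem, h.u_div, h.p_mem⟩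

lemma FirstOrderStep.regular {P : Params} {τ : ℝ} {s s' : State d}
    (h : FirstOrderStep Ω P τ s s') : s'.Regular Ω :=
  ⟨h.admissible.phi_mem.1, h.admissible.u_mem, h.div_eq, h.admissible.p_mem⟩

lemma BDF2Step.regular {P : Params} {τ γ : ℝ} {s s' s'' : State d}
    (h : BDF2Step Ω P τ γ s s' s'') : s''.Regular Ω :=
  ⟨h.admissible.phi_mem.1, h.admissible.u_mem, h.div_eq, h.admissible.p_mem⟩

/-- Each block becomes `¼(‖a‖² + ‖extrap b a‖²)` with the weight `1`, `λ`, `λβ` or `2λ` that its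
product has in `energy_balance`, so the discrete inequalities can simply be summed. -/
lemma pairEnergy_eq (hΩ : IsOpen Ω) (P : Params) (τ : ℝ) {s s' : State d} (h : s.Regular Ω)
    (h' : s'.Regular Ω) :
    pairEnergy Ω P τ s s' =
      1 / 4 * (‖liftL2 (volume.restrict Ω) s'.u‖ ^ 2
        + ‖extrap (liftL2 (volume.restrict Ω) s.u) (liftL2 (volume.restrict Ω) s'.u)‖ ^ 2)
      + P.lam * (1 / 4 * (‖liftL2 (volume.restrict Ω) (grad Ω s'.phi)‖ ^ 2
        + ‖extrap (liftL2 (volume.restrict Ω) (grad Ω s.phi))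
            (liftL2 (volume.restrict Ω) (grad Ω s'.phi))‖ ^ 2))
      + P.lam * P.beta * (1 / 4 * (‖liftL2 (volume.restrict Ω) s'.phi‖ ^ 2
        + ‖extrap (liftL2 (volume.restrict Ω) s.phi) (liftL2 (volume.restrict Ω) s'.phi)‖ ^ 2))
      + 2 * P.lam * (1 / 4 * (‖s'.R‖ ^ 2 + ‖extrap s.R s'.R‖ ^ 2))
      + P.nu * τ / 6 * ‖liftGrad Ω s'.u‖ ^ 2 := by
  rw [← liftL2_extrap h.u_mem.memLp h'.u_mem.memLp, ← liftL2_extrap h.phi_mem.1 h'.phi_mem.1,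
    ← liftL2_grad_extrap hΩ h.phi_mem h'.phi_mem, ← normSq_eq h'.phi_mem.1,
    ← normSq_eq (memLp_extrap h.phi_mem.1 h'.phi_mem.1), ← gradNormSq_eq h'.phi_mem,
    ← gradNormSq_eq (h.phi_mem.extrap hΩ h'.phi_mem), ← integral_norm_sq_eq h'.u_mem.memLp,
    ← integral_norm_sq_eq (memLp_extrap h.u_mem.memLp h'.u_mem.memLp),
    ← vgradNormSq_eq h'.u_mem.memH1, Real.norm_eq_abs, Real.norm_eq_abs]
  simp only [pairEnergy, vnormSq]
  ring

/-- The velocity correction in Hilbert space form. -/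
lemma projection_inner (hΩ : IsOpen Ω) {v v' w : Pt d → Pt d} {q p : Pt d → ℝ} {κ ν γ : ℝ}
    (hv : VecMemH2H10 Ω v) (hv' : VecMemH2H10 Ω v') (hq : MemH1 Ω q) (hp : MemH1 Ω p)
    (hw : VecMemH2H10 Ω w)
    (hdiv : ∀ᵐ x ∂(volume.restrict Ω), divergence Ω w x = 0)
    (h : ∀ᵐ x ∂(volume.restrict Ω),
      κ • (v x - v' x) - ν • vecLap Ω (fun y => v y - v' y) x + grad Ω q x
        = γ • grad Ω p x) :
    κ * inner ℝ (liftL2 (volume.restrict Ω) v - liftL2 (volume.restrict Ω) v')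
        (liftL2 (volume.restrict Ω) w)
      + ν * inner ℝ (liftGrad Ω v - liftGrad Ω v') (liftGrad Ω w) = 0 := by
  have e := projection_balance hΩ hv hv' hq hp (fun j => (hw j).2) hdiv h
  have hz : ∀ j, MemH1 Ω (fun x => (v x - v' x) j) := fun j => by
    have := (hv.memH1 j).lincomb hΩ (hv'.memH1 j) 1 (-1)
    rwa [← sub_eq] at this
  have s := sum_vip_grad_eq hz hw.memH1
  simp only [PiLp.sub_apply] at s
  rw [s, liftGrad_sub hΩ hv.memH1 hv'.memH1, vip,
    integral_inner_eq (f := fun x => v x - v' x) (hv.memLp.sub hv'.memLp) hw.memLp] at e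
  rw [← liftL2_sub hv.memLp hv'.memLp]
  exact e

lemma BDF2Step.energy_le (hd : d = 2 ∨ d = 3) (hΩ : IsOpen Ω) (hb : Bornology.IsBounded Ω)
    {P : Params} {τ γ : ℝ} (hτ : 0 < τ) {prev cur new : State d} (hprev : prev.Regular Ω)
    (hcur : cur.Regular Ω) (h : BDF2Step Ω P τ γ prev cur new) :
    pairEnergy Ω P τ cur new - pairEnergy Ω P τ prev cur ≤
      - P.M * τ * gradNormSq Ω new.mu - P.nu * τ / 6 *
        (vgradNormSq Ω (fun x => new.u x - new.uhat x) + vgradNormSq Ω new.uhat) := by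
  have hnew := h.regular
  have hh := h.admissible.uhat_mem
  have hpp := hprev.p_mem.extrap hΩ hcur.p_mem
  have bal := energy_balance hd hb P h.admissible hpp
    (MemH10.extrap hΩ (fun j => (hprev.u_mem j).2) fun j => (hcur.u_mem j).2)
    (MemH1.bdf2 hΩ τ hprev.phi_mem hcur.phi_mem hnew.phi_mem)
    (memLp_bdf2 (τ := τ) hprev.u_mem.memLp hcur.u_mem.memLp hh.memLp) rfl h.phi_eq h.mu_eq
    h.uhat_eq h.R_eq
  have hz : ∀ j, MemH1 Ω (fun x => (new.u x - new.uhat x) j) := fun j => by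
    have := (hnew.u_mem.memH1 j).lincomb hΩ (hh.memH1 j) 1 (-1)
    rwa [← sub_eq] at this
  rw [vip, integral_inner_eq hnew.phi_mem.memLp_grad
      (MemH1.bdf2 hΩ τ hprev.phi_mem hcur.phi_mem hnew.phi_mem).memLp_grad,
    liftL2_grad_bdf2 hΩ τ hprev.phi_mem hcur.phi_mem hnew.phi_mem,
    ip_eq_inner hnew.phi_mem.1 (memLp_bdf2 hprev.phi_mem.1 hcur.phi_mem.1 hnew.phi_mem.1),
    liftL2_bdf2 hprev.phi_mem.1 hcur.phi_mem.1 hnew.phi_mem.1, vip,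
    integral_inner_eq (memLp_bdf2 hprev.u_mem.memLp hcur.u_mem.memLp hh.memLp) hh.memLp,
    liftL2_bdf2 hprev.u_mem.memLp hcur.u_mem.memLp hh.memLp, vgradNormSq_eq hh.memH1] at bal
  rw [pairEnergy_eq hΩ P τ hcur hnew, pairEnergy_eq hΩ P τ hprev hcur, vgradNormSq_eq hz,
    liftGrad_sub hΩ hnew.u_mem.memH1 hh.memH1, vgradNormSq_eq hh.memH1]
  -- The same correction equation is tested with the new and the current velocity, both divergence
  -- free.
  have k1 := bdf2_velocity_inequality (c := liftL2 (volume.restrict Ω) prev.u) hτ P.nu_pos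
    (projection_inner hΩ hnew.u_mem hh hnew.p_mem hpp hnew.u_mem hnew.u_div h.u_eq)
    (projection_inner hΩ hnew.u_mem hh hnew.p_mem hpp hcur.u_mem hcur.u_div h.u_eq)
  have k2 := mul_le_mul_of_nonneg_left (bdf2_inequality hτ
    (liftL2 (volume.restrict Ω) (grad Ω new.phi)) (liftL2 (volume.restrict Ω) (grad Ω cur.phi))
    (liftL2 (volume.restrict Ω) (grad Ω prev.phi))) P.lam_pos.le
  have k3 := mul_le_mul_of_nonneg_left (bdf2_inequality hτ
    (liftL2 (volume.restrict Ω) new.phi) (liftL2 (volume.restrict Ω) cur.phi)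
    (liftL2 (volume.restrict Ω) prev.phi)) (mul_pos P.lam_pos P.beta_pos).le
  have k4 := mul_le_mul_of_nonneg_left (bdf2_inequality hτ new.R cur.R prev.R)
    (mul_pos two_pos P.lam_pos).le
  rw [RCLike.inner_apply, conj_trivial] at k4
  have bal' := congrArg (fun z => τ * z) bal
  simp only [mul_zero] at bal'
  linarith

lemma FirstOrderStep.energy_le (hd : d = 2 ∨ d = 3) (hΩ : IsOpen Ω)
    (hb : Bornology.IsBounded Ω) {P : Params} {τ : ℝ} (hτ : 0 < τ) {old new : State d}
    (hold : old.Regular Ω) (h : FirstOrderStep Ω P τ old new) :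
    pairEnergy Ω P τ old new - pairEnergy Ω P τ old old ≤
      - P.M * τ * gradNormSq Ω new.mu - P.nu * τ / 6 *
        (vgradNormSq Ω (fun x => new.u x - new.uhat x) + vgradNormSq Ω new.uhat) := by
  have hnew := h.regular
  have hh := h.admissible.uhat_mem
  have hdphi : MemH1 Ω (fun x => (new.phi x - old.phi x) / τ) := by
    rw [difference_quotient_eq]
    exact hnew.phi_mem.lincomb hΩ hold.phi_mem _ _
  have hdu : MemLp (fun x => (1 / τ) • (new.uhat x - old.u x)) 2 (volume.restrict Ω) :=
    (hh.memLp.sub hold.u_mem.memLp).const_smul (1 / τ)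
  have bal := energy_balance hd hb P h.admissible hold.p_mem (fun j => (hold.u_mem j).2)
    hdphi hdu rfl h.phi_eq h.mu_eq h.uhat_eq h.R_eq
  have hz : ∀ j, MemH1 Ω (fun x => (new.u x - new.uhat x) j) := fun j => by
    have := (hnew.u_mem.memH1 j).lincomb hΩ (hh.memH1 j) 1 (-1)
    rwa [← sub_eq] at this
  have eR : new.R * ((new.R - old.R) / τ) = 1 / τ * (new.R - old.R) * new.R := by ring
  have eu : vip Ω (fun x => (1 / τ) • (new.uhat x - old.u x)) new.uhat
      = inner ℝ ((1 / τ) • (liftL2 (volume.restrict Ω) new.uhat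
          - liftL2 (volume.restrict Ω) old.u)) (liftL2 (volume.restrict Ω) new.uhat) := by
    rw [← liftL2_sub hh.memLp hold.u_mem.memLp, real_inner_smul_left,
      ← integral_inner_eq (f := fun x => new.uhat x - old.u x) (hh.memLp.sub hold.u_mem.memLp)
        hh.memLp, ← integral_const_mul]
    simp only [vip, real_inner_smul_left]
  rw [vip, integral_inner_eq hnew.phi_mem.memLp_grad hdphi.memLp_grad,
    liftL2_grad_difference_quotient hΩ τ hnew.phi_mem hold.phi_mem,
    ip_eq_inner hnew.phi_mem.1 hdphi.1,
    liftL2_difference_quotient τ hnew.phi_mem.1 hold.phi_mem.1, eu, eR,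
    vgradNormSq_eq hh.memH1] at bal
  rw [pairEnergy_eq hΩ P τ hold hnew, pairEnergy_eq hΩ P τ hold hold, vgradNormSq_eq hz,
    liftGrad_sub hΩ hnew.u_mem.memH1 hh.memH1, vgradNormSq_eq hh.memH1]
  have k1 := euler_velocity_inequality hτ P.nu_pos
    (projection_inner hΩ hnew.u_mem hh hnew.p_mem hold.p_mem hnew.u_mem hnew.u_div h.u_eq)
    (projection_inner hΩ hnew.u_mem hh hnew.p_mem hold.p_mem hold.u_mem hold.u_div h.u_eq)
  have k2 := mul_le_mul_of_nonneg_left (euler_inequality hτ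
    (liftL2 (volume.restrict Ω) (grad Ω new.phi)) (liftL2 (volume.restrict Ω) (grad Ω old.phi)))
    P.lam_pos.le
  have k3 := mul_le_mul_of_nonneg_left (euler_inequality hτ
    (liftL2 (volume.restrict Ω) new.phi) (liftL2 (volume.restrict Ω) old.phi))
    (mul_pos P.lam_pos P.beta_pos).le
  have k4 := mul_le_mul_of_nonneg_left (euler_inequality hτ new.R old.R)
    (mul_pos two_pos P.lam_pos).le
  -- The balance enters with the factor `3/2`, which yields `3/2 M τ ‖∇μ‖²`; the surplus half is
  -- dropped.
  have k5 : 0 ≤ P.M * τ * gradNormSq Ω new.mu :=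
    mul_nonneg (mul_pos P.M_pos hτ).le (integral_nonneg fun x => sq_nonneg _)
  rw [RCLike.inner_apply, conj_trivial, smul_eq_mul] at k4
  have bal' := congrArg (fun z => τ * z) bal
  simp only [mul_zero] at bal'
  linarith

/-! ### Conservation of mass and regularity of all levels -/

lemma ip_one (f : Pt d → ℝ) : ip Ω f (fun _ => 1) = ∫ x in Ω, f x := by
  simp [ip]

lemma FirstOrderStep.mass_eq (hΩ : IsOpen Ω) (hfin : volume Ω ≠ ⊤) {P : Params} {τ : ℝ}
    (hτ : 0 < τ) {old new : State d} (hold : old.Regular Ω)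
    (h : FirstOrderStep Ω P τ old new) :
    ip Ω new.phi (fun _ => 1) = ip Ω old.phi (fun _ => 1) := by
  have : IsFiniteMeasure (volume.restrict Ω) := isFiniteMeasure_restrict.2 hfin
  have e := integral_time_derivative_eq_zero hΩ hfin hold.phi_mem (fun j => (hold.u_mem j).2)
    h.admissible.mu_mem h.admissible.mu_bc h.phi_eq
  rw [integral_div, integral_sub (h.regular.phi_mem.1.integrable one_le_two)
    (hold.phi_mem.1.integrable one_le_two), div_eq_zero_iff] at e
  rw [ip_one, ip_one]
  linarith [e.resolve_right hτ.ne']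

/-- The masses satisfy `3 mₙ₊₁ - 4 mₙ + mₙ₋₁ = 0`, which admits nonconstant solutions; `hmass` from
the preceding step excludes them. -/
lemma BDF2Step.mass_eq (hΩ : IsOpen Ω) (hfin : volume Ω ≠ ⊤) {P : Params} {τ γ : ℝ}
    (hτ : 0 < τ) {prev cur new : State d} (hprev : prev.Regular Ω) (hcur : cur.Regular Ω)
    (h : BDF2Step Ω P τ γ prev cur new)
    (hmass : ip Ω cur.phi (fun _ => 1) = ip Ω prev.phi (fun _ => 1)) :
    ip Ω new.phi (fun _ => 1) = ip Ω cur.phi (fun _ => 1) := by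
  have : IsFiniteMeasure (volume.restrict Ω) := isFiniteMeasure_restrict.2 hfin
  have e := integral_time_derivative_eq_zero hΩ hfin (hprev.phi_mem.extrap hΩ hcur.phi_mem)
    (MemH10.extrap hΩ (fun j => (hprev.u_mem j).2) fun j => (hcur.u_mem j).2)
    h.admissible.mu_mem h.admissible.mu_bc h.phi_eq
  have i1 := (h.regular.phi_mem.1.integrable one_le_two).const_mul 3
  have i2 := (hcur.phi_mem.1.integrable one_le_two).const_mul 4
  have i12 : Integrable (fun x => 3 * new.phi x - 4 * cur.phi x) (volume.restrict Ω) := i1.sub i2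
  have i3 := hprev.phi_mem.1.integrable one_le_two
  simp only [bdf2, Pi.smul_apply, Pi.add_apply, Pi.sub_apply, smul_eq_mul] at e
  rw [integral_const_mul, integral_add i12 i3, integral_sub i1 i2, integral_const_mul,
    integral_const_mul, mul_eq_zero] at e
  have e' := e.resolve_left (by positivity)
  rw [ip_one, ip_one] at hmass ⊢
  linarith

lemma IsSecondOrderSolution.regular {P : Params} {τ : ℝ} {Nt : ℕ} {γs : ℕ → ℝ}
    {s : ℕ → State d} (hs : IsSecondOrderSolution Ω P τ Nt γs s) :
    ∀ n, n ≤ Nt → (s n).Regular Ω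
  | 0, _ => hs.initial.regular
  | 1, _ => hs.first.regular
  | n + 2, h => (hs.step (n + 1) (by omega) h).regular

end CHNS

end

theorem mainTheorem5 (d : ℕ) (hd : d = 2 ∨ d = 3) (Ω : Set (CHNS.Pt d))
    (hΩ : CHNS.IsConvexPolytopalDomain Ω) (P : CHNS.Params)
    (hE : ∀ φ : CHNS.Pt d → ℝ, CHNS.MemH2 Ω φ → 0 < CHNS.E1 Ω P φ + P.delta0)
    (T : ℝ) (hT : 0 < T) (Nt : ℕ) (hNt : 0 < Nt) (τ : ℝ) (hτ : τ = T / Nt)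
    (γs : ℕ → ℝ) (s : ℕ → CHNS.State d)
    (hs : CHNS.IsSecondOrderSolution Ω P τ Nt γs s) :
    (∀ n, n + 1 ≤ Nt →
      CHNS.ip Ω (s (n + 1)).phi (fun _ => 1) = CHNS.ip Ω (s n).phi (fun _ => 1)) ∧
    (∀ n, n + 1 ≤ Nt →
      CHNS.modifiedEnergy Ω P τ s (n + 1) - CHNS.modifiedEnergy Ω P τ s n ≤
        - P.M * τ * CHNS.gradNormSq Ω (s (n + 1)).mu
          - P.nu * τ / 6 *
            (CHNS.vgradNormSq Ω (fun x => (s (n + 1)).u x - (s (n + 1)).uhat x)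
              + CHNS.vgradNormSq Ω (s (n + 1)).uhat)) := by
  have hτ0 : 0 < τ := by
    rw [hτ]
    exact div_pos hT (Nat.cast_pos.2 hNt)
  have hb := hΩ.isBounded
  have hfin : MeasureTheory.volume Ω ≠ ⊤ := hb.measure_lt_top.ne
  refine ⟨fun n => ?_, fun n hn => ?_⟩
  · induction n with
    | zero => exact fun _ => hs.first.mass_eq hΩ.isOpen hfin hτ0 hs.initial.regular
    | succ n ih =>
      exact fun hn => (hs.step (n + 1) (by omega) hn).mass_eq hΩ.isOpen hfin hτ0
        (hs.regular n (by omega)) (hs.regular (n + 1) (by omega)) (ih (by omega))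
  · cases n with
    -- `modifiedEnergy` at `0` unfolds to level `0` paired with itself, the form in which the
    -- first-order estimate is stated.
    | zero => exact hs.first.energy_le hd hΩ.isOpen hb hτ0 hs.initial.regular
    | succ n =>
      exact (hs.step (n + 1) (by omega) hn).energy_le hd hΩ.isOpen hb hτ0
        (hs.regular n (by omega)) (hs.regular (n + 1) (by omega))
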